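/- **Theorem 1.2.** Let $K$ be a commutative noetherian ring and let $\sigma\colon K\to S$ be a homomorphism of commutative rings that is essentially of finite type. Fix a factorization $$K\to K[x_1,\dots,x_e]\to V^{-1}K[x_1,\dots,x_e]=Q\twoheadrightarrow S$$ of $\sigma$, where $V$ is a multiplicatively closed set, the first two maps are canonical, and the last is a surjective homomorphism of rings. Let $\mathsf D(S)$ denote the unbounded derived category of $S$-modules, and set $$D^\sigma=\mathsf\Sigma^{e}\,\mathsf{R}\mathrm{Hom}_Q(S,\Omega^e_{Q|K})\in\mathsf D(S),\qquad \Omega^e_{Q|K}=\textstyle\bigwedge^e_Q\Omega_{Q|K},$$ where $\Omega_{Q|K}$ is the module of Kähler differentials. Let $\mathsf D^{\mathsf f}(\sigma)$ be the full subcategory of $\mathsf D(S)$ whose objects are the complexes $M$ such that the graded $S$-module $\mathrm H(M)$ is finitely generated and $M$ is isomorphic in $\mathsf D(K)$ to a bounded complex of flat $K$-modules. Assume that the flat dimension $\mathrm{fd}_K S$ is finite. Then: 1. For each $M\in\mathsf D^{\mathsf f}(\sigma)$ the complex $\mathsf{R}\mathrm{Hom}_S(M,D^\sigma)$ is in $\mathsf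 D^{\mathsf f}(\sigma)$, and the biduality morphism $$\delta^M\colon M\to\mathsf{R}\mathrm{Hom}_S(\mathsf{R}\mathrm{Hom}_S(M,D^\sigma),D^\sigma)$$ is an isomorphism in $\mathsf D(S)$. 2. The complex $D^\sigma$ is in $\mathsf D^{\mathsf f}(\sigma)$, and the homothety morphism $$\chi^{D^\sigma}\colon S\to\mathsf{R}\mathrm{Hom}_S(D^\sigma,D^\sigma)$$ is an isomorphism in $\mathsf D(S)$. -/

import Mathlib

open CategoryTheory CochainComplex.HomComplex

universe u

attribute [local instance] HasDerivedCategory.standard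

noncomputable section

namespace RelDual

/-- Unbounded cochain complexes of `R`-modules (cohomological grading: `M^i = M_{-i}`). -/
abbrev Cx (R : Type u) [CommRing R] := CochainComplex (ModuleCat.{u} R) ℤ

/-- A module viewed as a complex concentrated in degree `0`. -/
abbrev sgl (R : Type u) [CommRing R] (M : ModuleCat.{u} R) : Cx R :=
  (CochainComplex.singleFunctor (ModuleCat.{u} R) 0).obj M

/-- The (unbounded) derived category of `R`-modules. -/
abbrev D (R : Type u) [CommRing R] := DerivedCategory (ModuleCat.{u} R)

/-- The object of the derived category defined by a complex. -/
abbrev toD {R : Type u} [CommRing R] (M : Cx R) : D R := DerivedCategory.Q.obj M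

/-! ### Flat dimension of modules -/

/-- `M` has a flat resolution `0 → F_n → ⋯ → F_0 → M → 0` of length at most `n`. -/
def HasFlatResolutionOfLength {K : Type u} [CommRing K] (M : ModuleCat.{u} K) (n : ℕ) : Prop :=
  ∃ (F : Cx K) (ε : F ⟶ sgl K M),
    F.IsStrictlyGE (-(n : ℤ)) ∧ F.IsStrictlyLE 0 ∧ (∀ i, Module.Flat K (F.X i)) ∧ QuasiIso ε

/-- The flat dimension `fd_K M` of a module, with value `⊤` if there is no finite flat
resolution. -/
def flatDimension (K : Type u) [CommRing K] (M : Type u) [AddCommGroup M] [Module K M] : ℕ∞ :=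
  ⨅ (n : ℕ) (_ : HasFlatResolutionOfLength (ModuleCat.of K M) n), (n : ℕ∞)

/-! ### The category `D^f(σ)` -/

/-- `D^f(σ)`, for `σ : K → S` the structure map of a `K`-algebra: the complexes `X` in `D(S)` such
that the graded `S`-module `H(X)` is finitely generated, and `X` is isomorphic in `D(K)` to a
bounded complex of flat `K`-modules. -/
def Df (K S : Type u) [CommRing K] [CommRing S] [Algebra K S] : ObjectProperty (D S) := fun X =>
  Module.Finite S
      (DirectSum ℤ fun i => ((DerivedCategory.homologyFunctor (ModuleCat.{u} S) i).obj X)) ∧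
    ∃ (F : Cx K) (a b : ℤ), F.IsStrictlyGE a ∧ F.IsStrictlyLE b ∧
      (∀ i, Module.Flat K (F.X i)) ∧
      Nonempty ((ModuleCat.restrictScalars.{u} (algebraMap K S)).mapDerivedCategory.obj X ≅ toD F)

/-! ### Hom complexes -/

section Hom

variable {S : Type u} [CommRing S]

/-- The complex of `S`-modules `Hom_S(M, N)`. In degree `n` it consists of the families of linear
maps `f : M^p → N^q`, `p + n = q`, and the differential is `f ↦ d ∘ f - (-1)^n f ∘ d`. -/
def homCx (M N : Cx S) : Cx S where
  X n := ModuleCat.of S (Cochain M N n)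
  d i j := ModuleCat.ofHom (δ_hom S M N i j)
  shape _ _ hij := by ext; simp [δ_shape _ _ hij]
  d_comp_d' _ _ _ _ _ := by ext; simp [δ_δ]

/-- Evaluation at `x ∈ M^p`, `f ↦ (-1)^{np} f(x)` for `f ∈ Hom_S(M, J)^n`. -/
def evalCochain (M J : Cx S) (p : ℤ) (x : M.X p) : Cochain (homCx M J) J p :=
  Cochain.mk fun n q h => ModuleCat.ofHom
    { toFun := fun f : Cochain M J n =>
        (n * p).negOnePow • (f.v p q (by rw [add_comm]; exact h)).hom x
      map_add' := fun f g => by simp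
      map_smul' := fun s f => by
        simp only [Cochain.smul_v, RingHom.id_apply, ModuleCat.hom_smul, LinearMap.smul_apply]
        rw [smul_comm] }

lemma evalCochain_apply (M J : Cx S) (p : ℤ) (x : M.X p) (n q : ℤ) (h : n + p = q)
    (f : Cochain M J n) :
    (((evalCochain M J p x).v n q h).hom f : J.X q) =
      (n * p).negOnePow • (f.v p q (by rw [add_comm]; exact h)).hom x := rfl

lemma eval_d_aux {M J : Cx S} (n p q : ℤ) (h : p + 1 + n = q) (f : Cochain M J n) (x : M.X p) :
    J.d (q - 1) q ((n * p).negOnePow • f.v p (q - 1) (by lia) x) +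
      (p + 1).negOnePow • ((n + 1) * p).negOnePow • (δ n (n + 1) f).v p q (by lia) x =
    (n * (p + 1)).negOnePow • f.v (p + 1) q h (M.d p (p + 1) x) := by
  rw [δ_v n (n + 1) rfl f p q (by lia) (q - 1) (p + 1) rfl rfl]
  have key : ∀ a b : J.X q,
      (n * p).negOnePow • a + (p + 1).negOnePow • ((n + 1) * p).negOnePow •
        (a + (n + 1).negOnePow • b) = (n * (p + 1)).negOnePow • b := by
    intro a b
    rcases Int.even_or_odd n with hn | hn <;> rcases Int.even_or_odd p with hp | hp <;>
      simp [Int.negOnePow_even, Int.negOnePow_odd, hn, hp, add_mul, mul_add,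
        Int.negOnePow_add]
  rw [← key ((J.d (q - 1) q) (f.v p (q - 1) (by lia) x))]
  simp only [Units.smul_def, ModuleCat.hom_add, LinearMap.add_apply, map_zsmul]
  rfl

/-- The biduality morphism of complexes `M → Hom_S(Hom_S(M, J), J)`, which maps `x` to
`f ↦ (-1)^{|x||f|} f(x)`. -/
def biduality (M J : Cx S) : M ⟶ homCx (homCx M J) J where
  f p := ModuleCat.ofHom
    { toFun := fun x => evalCochain M J p x
      map_add' := fun x y => by
        ext n q h f
        refine (evalCochain_apply M J p (x + y) n q h f).trans ?_
        rw [map_add, smul_add]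
        rfl
      map_smul' := fun s x => by
        ext n q h f
        refine (evalCochain_apply M J p (s • x) n q h f).trans ?_
        rw [map_smul, smul_comm]
        rfl }
  comm' p p' hp := by
    ext x : 2
    change δ p p' (evalCochain M J p x) = evalCochain M J p' (M.d p p' x)
    have hp' : p + 1 = p' := hp
    ext n q h f
    rw [δ_v p p' hp' _ n q h (q - 1) (n + 1) rfl rfl]
    subst hp'
    exact eval_d_aux n p q (by lia) f x

/-- The homothety morphism of complexes `S → Hom_S(M, N)`, `s ↦ s • ι`, defined by a morphism
`ι : M → N`. -/
def homothety {M N : Cx S} (ι : M ⟶ N) : sgl S (ModuleCat.of S S) ⟶ homCx M N :=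
  HomologicalComplex.mkHomFromSingle
    (ModuleCat.ofHom (LinearMap.toSpanSingleton S (Cochain M N 0) (Cochain.ofHom ι)))
    (fun k _ => by
      ext
      change δ 0 k ((1 : S) • Cochain.ofHom ι) = 0
      simp)

end Hom

/-! ### Derived Hom -/

/-- A K-injective resolution of a complex `N`: a quasi-isomorphism `N → J` with `J` K-injective. -/
structure KInjectiveResolution {R : Type u} [CommRing R] (N : Cx R) where
  /-- the K-injective complex -/
  J : Cx R
  /-- the quasi-isomorphism -/
  ι : N ⟶ J
  quasiIso : QuasiIso ι
  isKInjective : J.IsKInjective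

/-- The K-injective resolution of a module given by an injective resolution. -/
def KInjectiveResolution.ofModule {R : Type u} [CommRing R] (M : ModuleCat.{u} R) :
    KInjectiveResolution (sgl R M) where
  J := (injectiveResolution M).cochainComplex
  ι := (injectiveResolution M).ι'
  quasiIso := inferInstance
  isKInjective := inferInstance

/-- `RHom_S(M, N)`, computed by a K-injective resolution `N → J` as `Hom_S(M, J)`. -/
def RHom {S : Type u} [CommRing S] (M : Cx S) {N : Cx S} (r : KInjectiveResolution N) : Cx S :=
  homCx M r.J

/-- `RHom_Q(S, N)` as a complex of `S`-modules, for a ring homomorphism `π : Q → S` and a complex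
`N` of `Q`-modules with K-injective resolution `N → J`: it is the complex `Hom_Q(S, J)`, on which
`S` acts through the first argument. -/
def RHomAlong {Q S : Type u} [CommRing Q] [CommRing S] (π : Q →+* S) {N : Cx Q}
    (r : KInjectiveResolution N) : Cx S :=
  ((ModuleCat.coextendScalars.{u} π).mapHomologicalComplex (ComplexShape.up ℤ)).obj r.J

/-- Coextension of scalars preserves injective modules. -/
lemma injective_coextendScalars {Q S : Type u} [CommRing Q] [CommRing S] (π : Q →+* S)
    (I : ModuleCat.{u} Q) [Injective I] :
    Injective ((ModuleCat.coextendScalars.{u} π).obj I) :=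
  (ModuleCat.restrictCoextendScalarsAdj.{u} π).map_injective I inferInstance

/-! ### The relative dualizing complex -/

/-- `D^σ = Σ^e RHom_Q(S, Ω^e_{Q|K})` for a factorization
`K → K[x_1, …, x_e] → V⁻¹K[x_1, …, x_e] = Q → S` of the structure map `σ : K → S`,
where `π : Q → S`. -/
def relDualizing {K S : Type u} [CommRing K] [CommRing S] [Algebra K S] {e : ℕ}
    {V : Submonoid (MvPolynomial (Fin e) K)} (π : Localization V →ₐ[K] S) : Cx S :=
  (RHomAlong (π : Localization V →+* S)
    (KInjectiveResolution.ofModule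
      (ModuleCat.of (Localization V) (⋀[Localization V]^e (Ω[Localization V⁄K])))))⟦(e : ℤ)⟧

/-- The complex chosen to represent `D^σ` is K-injective, so it has K-injective resolutions. -/
lemma nonempty_kInjectiveResolution_relDualizing {K S : Type u} [CommRing K] [CommRing S]
    [Algebra K S] {e : ℕ} {V : Submonoid (MvPolynomial (Fin e) K)} (π : Localization V →ₐ[K] S) :
    Nonempty (KInjectiveResolution (relDualizing π)) := by
  let M := ModuleCat.of (Localization V) (⋀[Localization V]^e (Ω[Localization V⁄K]))
  let C : Cx S := RHomAlong (π : Localization V →+* S) (KInjectiveResolution.ofModule M)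
  have h₁ : ∀ n, Injective (C.X n) := fun n =>
    injective_coextendScalars (π : Localization V →+* S) ((injectiveResolution M).cochainComplex.X n)
  have h₂ : C.IsStrictlyGE 0 := by
    dsimp only [C, RHomAlong, KInjectiveResolution.ofModule]
    infer_instance
  have h₃ : C.IsKInjective := CochainComplex.isKInjective_of_injective C 0
  exact ⟨{ J := C⟦(e : ℤ)⟧, ι := 𝟙 _,
           quasiIso := (inferInstance : QuasiIso (𝟙 (C⟦(e : ℤ)⟧))),
           isKInjective := inferInstance }⟩

/-! ### The comparison morphisms -/

/-- The biduality morphism `δ^M : M → RHom_S(RHom_S(M, N), N)` in `D(S)`. -/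
def bidualityD {S : Type u} [CommRing S] (M : Cx S) {N : Cx S} (r : KInjectiveResolution N) :
    toD M ⟶ toD (RHom (RHom M r) r) :=
  DerivedCategory.Q.map (biduality M r.J)

/-- The homothety morphism `χ^N : S → RHom_S(N, N)` in `D(S)`. -/
def homothetyD {S : Type u} [CommRing S] {N : Cx S} (r : KInjectiveResolution N) :
    toD (sgl S (ModuleCat.of S S)) ⟶ toD (RHom N r) :=
  DerivedCategory.Q.map (homothety r.ι)

end RelDual

end

noncomputable section

namespace RelDual

/-! Write `P = K[x_1, …, x_e]` and `Q = V⁻¹P`. By adjunction `Hom_S(M, Hom_Q(S, I)) ≅ Hom_Q(M, I)`,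
so after restriction to `Q` duality with respect to `D^σ` becomes duality with respect to `Ω^e[e]`,
and restriction detects quasi-isomorphisms. As `Ω^e` is free of rank one over `Q`, this is the usual
duality `RHom_Q(-, Q)` up to a shift. On bounded complexes of finite projectives it preserves the
class, and biduality is degreewise the reflexivity of finite projective modules. The chain-level
squares `biduality_mapRight`, `biduality_naturality` and `biduality_homAdj` carry this back to `S`.

It remains to see that `D^f(σ)` consists of complexes that are perfect over `Q`. One direction
(`df_of_isPerfectCx`) holds because `Q` is noetherian and flat over `K`, and `Q → S` is onto. For
the other (`isPerfect_of_df`), flat dimension is measured by vanishing of Ext into character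
modules. A bounded flat complex over `K` has such vanishing. Passing from `K` to `P` costs one
degree per variable, by the exact sequence `0 → Y → Hom_A(A[t], Y) → Hom_A(A[t], Y) → 0`. Over `Q`
one then strips off finite free modules from the top homology until a single finite module is left,
whose Ext vanishing makes it flat over `P`. It is therefore flat over the localization `Q`, and
projective since it is finitely presented.

The second assertion is the first one for `M = S`: finiteness of `fd_K S` puts `S` in `D^f(σ)`,
evaluation at one gives `RHom_S(S, D^σ) ≅ D^σ`, and this turns the homothety into the biduality
morphism of `S`. -/

/-- An elementwise criterion for a morphism of complexes of modules to be a quasi-isomorphism. -/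
lemma quasiIso_of_elementwise {S : Type u} [CommRing S] {A B : Cx S} (f : A ⟶ B)
    (inj : ∀ (i j k : ℤ), i + 1 = j → j + 1 = k → ∀ (a : A.X j) (b : B.X i),
      A.d j k a = 0 → f.f j a = B.d i j b → ∃ a' : A.X i, a = A.d i j a')
    (surj : ∀ (i j k : ℤ), i + 1 = j → j + 1 = k → ∀ (b : B.X j), B.d j k b = 0 →
      ∃ (a : A.X j) (b' : B.X i), A.d j k a = 0 ∧ b = f.f j a + B.d i j b') :
    QuasiIso f := by
  rw [quasiIso_iff]
  intro j
  rw [quasiIsoAt_iff_isIso_homologyMap]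
  have hi : (ComplexShape.up ℤ).prev j = j - 1 := by simp
  have hk : (ComplexShape.up ℤ).next j = j + 1 := by simp
  -- Elementwise choices need not be linear in `x : X`; they become so on the free module on the
  -- underlying set of `X`, which serves as the refinement.
  have hepi (X : ModuleCat.{u} S) :
      Epi (ModuleCat.ofHom (Finsupp.linearCombination S (id : X → X))) := by
    rw [ModuleCat.epi_iff_surjective]
    exact fun x => ⟨Finsupp.single x 1, by simp⟩
  have : Mono (HomologicalComplex.homologyMap f j) := by
    rw [HomologicalComplex.mono_homologyMap_iff_up_to_refinements f _ _ _ hi hk]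
    intro X x₂ hx₂ y₁ hy
    have h (x : X) : ∃ a' : A.X (j - 1), x₂ x = A.d (j - 1) j a' :=
      inj _ _ _ (by simp) rfl (x₂ x) (y₁ x) (congr($hx₂ x)) (congr($hy x))
    choose a ha using h
    refine ⟨_, _, hepi X, ModuleCat.ofHom (Finsupp.linearCombination S a), ?_⟩
    ext x
    simp [ha]
  have : Epi (HomologicalComplex.homologyMap f j) := by
    rw [HomologicalComplex.epi_homologyMap_iff_up_to_refinements f _ _ _ hi hk]
    intro X y₂ hy₂
    have h (x : X) := surj (j - 1) j (j + 1) (by simp) rfl (y₂ x) (congr($hy₂ x))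
    choose a b ha hb using h
    refine ⟨_, _, hepi X, ModuleCat.ofHom (Finsupp.linearCombination S a), ?_,
      ModuleCat.ofHom (Finsupp.linearCombination S b), ?_⟩
    · ext x
      simp [ha]
    · ext x
      simp [hb]
  exact isIso_of_mono_of_epi _

lemma quasiIso_of_bijective {S : Type u} [CommRing S] {A B : Cx S} (f : A ⟶ B)
    (h : ∀ n, Function.Bijective (f.f n)) : QuasiIso f := by
  have (n : ℤ) : IsIso (f.f n) := (ConcreteCategory.isIso_iff_bijective _).2 (h n)
  have : IsIso f := HomologicalComplex.Hom.isIso_of_components f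
  infer_instance

/-! ### Hom complexes: functoriality and preservation of quasi-isomorphisms -/

section Functoriality

variable {S : Type u} [CommRing S]

/-- Postcomposition `Hom(M, J) → Hom(M, J')` with a morphism of complexes `J → J'`. -/
def mapRight (M : Cx S) {J J' : Cx S} (φ : J ⟶ J') : homCx M J ⟶ homCx M J' where
  f n := ModuleCat.ofHom
    { toFun := fun f : Cochain M J n => f.comp (Cochain.ofHom φ) (add_zero n)
      map_add' := fun f g => by simp
      map_smul' := fun s f => by simp }
  comm' i j _ := by
    ext f : 2
    exact δ_comp_ofHom (f : Cochain M J i) φ j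

/-- Precomposition `Hom(M', J) → Hom(M, J)` with a morphism of complexes `M → M'`. -/
def mapLeft {M M' : Cx S} (g : M ⟶ M') (J : Cx S) : homCx M' J ⟶ homCx M J where
  f n := ModuleCat.ofHom
    { toFun := fun f : Cochain M' J n => (Cochain.ofHom g).comp f (zero_add n)
      map_add' := fun f g => by simp
      map_smul' := fun s f => by simp }
  comm' i j _ := by
    ext f : 2
    exact δ_ofHom_comp g (f : Cochain M' J i) j

/-- The target of biduality is covariant and contravariant in `J` at once, so a change of `J` gives
a square through `Hom(Hom(M, J), J')` rather than a naturality square. -/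
lemma biduality_mapRight (M : Cx S) {J J' : Cx S} (φ : J ⟶ J') :
    biduality M J ≫ mapRight (homCx M J) φ = biduality M J' ≫ mapLeft (mapRight M φ) J' := by
  ext p x : 3
  refine Cochain.ext _ _ fun n q h => ModuleCat.hom_ext <|
    LinearMap.ext fun (f : Cochain M J n) => ?_
  have hpq : p + n = q := by rw [add_comm]; exact h
  change (((evalCochain M J p x).comp (Cochain.ofHom φ) (add_zero p)).v n q h).hom f =
    (((Cochain.ofHom (mapRight M φ)).comp (evalCochain M J' p x) (zero_add p)).v n q h).hom f
  rw [Cochain.comp_zero_cochain_v, Cochain.zero_cochain_comp_v, Cochain.ofHom_v, Cochain.ofHom_v]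
  change φ.f q ((n * p).negOnePow • (f : Cochain M J n).v p q hpq x) =
    (n * p).negOnePow • ((f : Cochain M J n).comp (Cochain.ofHom φ) (add_zero n)).v p q hpq x
  simp [Units.smul_def]

lemma biduality_naturality {M M' : Cx S} (g : M ⟶ M') (J : Cx S) :
    g ≫ biduality M' J = biduality M J ≫ mapLeft (mapLeft g J) J := by
  ext p x : 3
  refine Cochain.ext _ _ fun n q h => ModuleCat.hom_ext <|
    LinearMap.ext fun (f : Cochain M' J n) => ?_
  have hpq : p + n = q := by rw [add_comm]; exact h
  change ((evalCochain M' J p (g.f p x)).v n q h).hom f =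
    (((Cochain.ofHom (mapLeft g J)).comp (evalCochain M J p x) (zero_add p)).v n q h).hom f
  rw [Cochain.zero_cochain_comp_v, Cochain.ofHom_v]
  change (n * p).negOnePow • (f : Cochain M' J n).v p q hpq (g.f p x) =
    (n * p).negOnePow • ((Cochain.ofHom g).comp (f : Cochain M' J n) (zero_add n)).v p q hpq x
  simp

/-- The degree `n` cohomology of `Hom(M, J)` is the group of homotopy classes of maps `M → J⟦n⟧`, so
the hypothesis is bijectivity in cohomology. -/
lemma quasiIso_mapRight_of_bijective (M : Cx S) {J J' : Cx S} (φ : J ⟶ J')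
    (h : ∀ n, Function.Bijective
      (fun x : (HomotopyCategory.quotient (ModuleCat.{u} S) (ComplexShape.up ℤ)).obj M ⟶
        (HomotopyCategory.quotient _ _).obj (J⟦(n : ℤ)⟧) =>
          x ≫ (HomotopyCategory.quotient _ _).map (φ⟦n⟧'))) :
    QuasiIso (mapRight M φ) := by
  have key (n : ℤ) (z : Cocycle M J n) : CohomologyClass.toHom (CohomologyClass.mk (z.postcomp φ)) =
      CohomologyClass.toHom (CohomologyClass.mk z) ≫
        (HomotopyCategory.quotient _ _).map (φ⟦n⟧') := by
    rw [CohomologyClass.toHom_mk, CohomologyClass.toHom_mk, Cocycle.equivHomShift_symm_postcomp,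
      Functor.map_comp]
  refine quasiIso_of_elementwise _ ?_ ?_
  · intro i j k hij hjk a b ha hb
    let z : Cocycle M J j := Cocycle.mk a k hjk ha
    have h1 : CohomologyClass.toHom (CohomologyClass.mk (z.postcomp φ)) = 0 := by
      rw [CohomologyClass.toHom_mk_eq_zero_iff]
      exact ⟨i, hij, b, hb.symm⟩
    rw [key] at h1
    have h2 : CohomologyClass.toHom (CohomologyClass.mk z) = 0 := (h j).1 (by simpa using h1)
    rw [CohomologyClass.toHom_mk_eq_zero_iff] at h2
    obtain ⟨m, hm, β, hβ⟩ := h2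
    obtain rfl : m = i := by lia
    exact ⟨β, hβ.symm⟩
  · intro i j k hij hjk b hb
    let z : Cocycle M J' j := Cocycle.mk b k hjk hb
    obtain ⟨y, hy⟩ := (h j).2 (CohomologyClass.toHom (CohomologyClass.mk z))
    obtain ⟨y, rfl⟩ := (CohomologyClass.toHom_bijective M J j).2 y
    obtain ⟨y, rfl⟩ := CohomologyClass.mk_surjective y
    dsimp only at hy
    rw [← key] at hy
    have := (CohomologyClass.toHom_bijective M J' j).1 hy
    rw [← sub_eq_zero, ← CohomologyClass.mk_sub, CohomologyClass.mk_eq_zero_iff] at this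
    obtain ⟨m, hm, β, hβ⟩ := this
    obtain rfl : m = i := by lia
    refine ⟨y.1, (-β : Cochain M J' m), y.δ_eq_zero k, ?_⟩
    change z.1 = (y.postcomp φ).1 + δ m j (-β)
    rw [δ_neg, hβ]
    simp

lemma quasiIso_mapLeft_of_bijective {M M' : Cx S} (g : M ⟶ M') (J : Cx S)
    (h : ∀ n, Function.Bijective
      (fun x : (HomotopyCategory.quotient (ModuleCat.{u} S) (ComplexShape.up ℤ)).obj M' ⟶
        (HomotopyCategory.quotient _ _).obj (J⟦(n : ℤ)⟧) =>
          (HomotopyCategory.quotient _ _).map g ≫ x)) :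
    QuasiIso (mapLeft g J) := by
  have key (n : ℤ) (z : Cocycle M' J n) : CohomologyClass.toHom (CohomologyClass.mk (z.precomp g)) =
      (HomotopyCategory.quotient _ _).map g ≫ CohomologyClass.toHom (CohomologyClass.mk z) := by
    rw [CohomologyClass.toHom_mk, CohomologyClass.toHom_mk, Cocycle.equivHomShift_symm_precomp,
      Functor.map_comp]
  refine quasiIso_of_elementwise _ ?_ ?_
  · intro i j k hij hjk a b ha hb
    let z : Cocycle M' J j := Cocycle.mk a k hjk ha
    have h1 : CohomologyClass.toHom (CohomologyClass.mk (z.precomp g)) = 0 := by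
      rw [CohomologyClass.toHom_mk_eq_zero_iff]
      exact ⟨i, hij, b, hb.symm⟩
    rw [key] at h1
    have h2 : CohomologyClass.toHom (CohomologyClass.mk z) = 0 := (h j).1 (by simpa using h1)
    rw [CohomologyClass.toHom_mk_eq_zero_iff] at h2
    obtain ⟨m, hm, β, hβ⟩ := h2
    obtain rfl : m = i := by lia
    exact ⟨β, hβ.symm⟩
  · intro i j k hij hjk b hb
    let z : Cocycle M J j := Cocycle.mk b k hjk hb
    obtain ⟨y, hy⟩ := (h j).2 (CohomologyClass.toHom (CohomologyClass.mk z))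
    obtain ⟨y, rfl⟩ := (CohomologyClass.toHom_bijective M' J j).2 y
    obtain ⟨y, rfl⟩ := CohomologyClass.mk_surjective y
    dsimp only at hy
    rw [← key] at hy
    have := (CohomologyClass.toHom_bijective M J j).1 hy
    rw [← sub_eq_zero, ← CohomologyClass.mk_sub, CohomologyClass.mk_eq_zero_iff] at this
    obtain ⟨m, hm, β, hβ⟩ := this
    obtain rfl : m = i := by lia
    refine ⟨y.1, (-β : Cochain M J m), y.δ_eq_zero k, ?_⟩
    change z.1 = (y.precomp g).1 + δ m j (-β)
    rw [δ_neg, hβ]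
    simp

instance isIso_Qh_map_quotient_map {A B : Cx S} (f : A ⟶ B) [QuasiIso f] :
    IsIso (DerivedCategory.Qh.map ((HomotopyCategory.quotient _ _).map f)) := by
  rw [DerivedCategory.isIso_Qh_map_iff, HomotopyCategory.quotient_map_mem_quasiIso_iff]
  simpa only [HomologicalComplex.mem_quasiIso_iff]

/-- `Hom(-, J)` preserves quasi-isomorphisms if `J` is K-injective. -/
lemma quasiIso_mapLeft {M M' : Cx S} (g : M ⟶ M') [QuasiIso g] (J : Cx S) [J.IsKInjective] :
    QuasiIso (mapLeft g J) := by
  refine quasiIso_mapLeft_of_bijective g J fun n => ?_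
  have e1 := CochainComplex.IsKInjective.Qh_map_bijective
    ((HomotopyCategory.quotient _ _).obj M') (J⟦n⟧)
  have e2 := CochainComplex.IsKInjective.Qh_map_bijective
    ((HomotopyCategory.quotient _ _).obj M) (J⟦n⟧)
  have e3 := ((asIso (DerivedCategory.Qh.map ((HomotopyCategory.quotient _ _).map g))).homFromEquiv
    (Z := DerivedCategory.Qh.obj ((HomotopyCategory.quotient _ _).obj (J⟦n⟧)))).symm.bijective
  -- Maps into a K-injective complex are the same in the homotopy and derived categories; in the
  -- latter `g` is invertible.
  refine (Function.Bijective.of_comp_iff' e2 _).1 ?_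
  convert! e3.comp e1 using 1
  ext x
  exact Functor.map_comp _ _ _

instance quasiIso_shift {A B : Cx S} (f : A ⟶ B) [QuasiIso f] (n : ℤ) : QuasiIso (f⟦n⟧') :=
  (CochainComplex.quasiIso_shift_iff f n).2 inferInstance

/-- `Hom(M, -)` preserves quasi-isomorphisms between K-injective complexes. -/
lemma quasiIso_mapRight_of_isKInjective (M : Cx S) {J J' : Cx S} (φ : J ⟶ J') [QuasiIso φ]
    [J.IsKInjective] [J'.IsKInjective] : QuasiIso (mapRight M φ) := by
  refine quasiIso_mapRight_of_bijective M φ fun n => ?_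
  have e1 := CochainComplex.IsKInjective.Qh_map_bijective
    ((HomotopyCategory.quotient _ _).obj M) (J⟦n⟧)
  have e2 := CochainComplex.IsKInjective.Qh_map_bijective
    ((HomotopyCategory.quotient _ _).obj M) (J'⟦n⟧)
  have e3 := ((asIso (DerivedCategory.Qh.map
    ((HomotopyCategory.quotient _ _).map (φ⟦n⟧')))).homToEquiv
    (Z := DerivedCategory.Qh.obj ((HomotopyCategory.quotient _ _).obj M))).bijective
  refine (Function.Bijective.of_comp_iff' e2 _).1 ?_
  convert! e3.comp e1 using 1
  ext x
  exact Functor.map_comp _ _ _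

/-- `Hom(M, -)` preserves quasi-isomorphisms if `M` is K-projective. -/
lemma quasiIso_mapRight_of_isKProjective (M : Cx S) [M.IsKProjective] {J J' : Cx S} (φ : J ⟶ J')
    [QuasiIso φ] : QuasiIso (mapRight M φ) := by
  refine quasiIso_mapRight_of_bijective M φ fun n => ?_
  have e1 := CochainComplex.IsKProjective.Qh_map_bijective M
    ((HomotopyCategory.quotient _ _).obj (J⟦n⟧))
  have e2 := CochainComplex.IsKProjective.Qh_map_bijective M
    ((HomotopyCategory.quotient _ _).obj (J'⟦n⟧))
  have e3 := ((asIso (DerivedCategory.Qh.map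
    ((HomotopyCategory.quotient _ _).map (φ⟦n⟧')))).homToEquiv
    (Z := DerivedCategory.Qh.obj ((HomotopyCategory.quotient _ _).obj M))).bijective
  refine (Function.Bijective.of_comp_iff' e2 _).1 ?_
  convert! e3.comp e1 using 1
  ext x
  exact Functor.map_comp _ _ _

end Functoriality

/-! ### Biduality for finite projectives and a shift of the ring -/

section Concentrated

variable {S : Type u} [CommRing S]

/-- Cochains with values in a complex concentrated in degree `m` are linear maps. -/
def cochainEquiv {L : Cx S} {m : ℤ} (hL : ∀ i, i ≠ m → Limits.IsZero (L.X i)) (A : Cx S)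
    {p n : ℤ} (h : p + n = m) : Cochain A L n ≃ₗ[S] (A.X p →ₗ[S] L.X m) where
  toFun f := (f.v p m h).hom
  map_add' f g := by simp
  map_smul' s f := by simp
  invFun g := Cochain.single (ModuleCat.ofHom g) n
  left_inv f := by
    ext p' q' h' : 1
    by_cases hq : q' = m
    · subst hq
      obtain rfl : p' = p := by lia
      simp
    · exact (hL q' hq).eq_of_tgt _ _
  right_inv g := by simp

/-- Reflexivity of finite projective modules, with the dualizing module `S` replaced by a copy `N`.
-/
lemma bijective_eval_of_equiv {T N : Type u} [AddCommGroup T] [Module S T] [Module.Finite S T]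
    [Module.Projective S T] [AddCommGroup N] [Module S N] (l : N ≃ₗ[S] S) :
    Function.Bijective (fun (x : T) => (LinearMap.applyₗ x : (T →ₗ[S] N) →ₗ[S] N)) := by
  have hb := Module.IsReflexive.bijective_dual_eval' (R := S) (M := T)
  constructor
  · intro x y hxy
    refine hb.1 (LinearMap.ext fun g => ?_)
    exact l.symm.injective (congr($hxy (l.symm.toLinearMap ∘ₗ g)))
  · intro c
    obtain ⟨x, hx⟩ := hb.2 (l.toLinearMap ∘ₗ c ∘ₗ (LinearMap.compRight S l.symm.toLinearMap))
    refine ⟨x, LinearMap.ext fun g => l.injective ?_⟩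
    have := congr($hx (l.toLinearMap ∘ₗ g))
    have h2 : l.symm.toLinearMap ∘ₗ l.toLinearMap ∘ₗ g = g := by ext; simp
    simpa [h2] using this

/-- Biduality for a complex of finite projective modules with respect to a shift of the ring. -/
lemma bijective_biduality {L : Cx S} {m : ℤ} (hL : ∀ i, i ≠ m → Limits.IsZero (L.X i))
    (l : L.X m ≃ₗ[S] S) (T : Cx S) [∀ p, Module.Finite S (T.X p)]
    [∀ p, Module.Projective S (T.X p)] (p : ℤ) :
    Function.Bijective ((biduality T L).f p) := by
  -- Since `L` lives in degree `m`, the double dual in degree `p` is `Hom(Hom(T^p, L^m), L^m)`.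
  let e := cochainEquiv hL T (show p + (m - p) = m by lia)
  let e' := cochainEquiv hL (homCx T L) (show (m - p) + p = m by lia)
  have hb := bijective_eval_of_equiv (T := T.X p) l
  have key (x : T.X p) : e' (evalCochain T L p x) =
      ((m - p) * p).negOnePow • (LinearMap.applyₗ x ∘ₗ e.toLinearMap :
        Cochain T L (m - p) →ₗ[S] L.X m) := by
    refine LinearMap.ext fun f => ?_
    exact evalCochain_apply T L p x (m - p) m (by lia) f
  constructor
  · intro x y hxy
    have h1 : evalCochain T L p x = evalCochain T L p y := hxy
    have h2 := congr(e' $h1)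
    rw [key, key] at h2
    apply hb.1
    refine LinearMap.ext fun g => ?_
    obtain ⟨f, rfl⟩ := e.surjective g
    exact congr($(smul_left_cancel _ h2) f)
  · intro c
    -- Biduality is evaluation up to the sign `(-1)^{(m-p)p}`; being its own inverse, the sign is
    -- absorbed in the functional to be represented.
    obtain ⟨x, hx⟩ := hb.2 (((m - p) * p).negOnePow • (e' c ∘ₗ e.symm.toLinearMap))
    refine ⟨x, e'.injective ?_⟩
    refine (key x).trans ?_
    dsimp only at hx
    rw [hx]
    refine LinearMap.ext fun f => ?_
    have : (((m - p) * p).negOnePow • ((m - p) * p).negOnePow • e' c f) = e' c f := by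
      rw [smul_smul, ← Int.negOnePow_add, Int.negOnePow_even _ (by simp), one_smul]
    have h2 : e.symm (e f) = (f : Cochain T L (m - p)) := e.symm_apply_apply f
    change ((m - p) * p).negOnePow • ((m - p) * p).negOnePow • e' c (e.symm (e f)) = e' c f
    rw [h2]
    exact this

end Concentrated

/-- A bounded complex of finite projective modules. -/
structure IsPerfectCx {S : Type u} [CommRing S] (T : Cx S) : Prop where
  finite (p : ℤ) : Module.Finite S (T.X p)
  projective (p : ℤ) : Module.Projective S (T.X p)
  bounded : ∃ a b, T.IsStrictlyGE a ∧ T.IsStrictlyLE b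

namespace IsPerfectCx

variable {S : Type u} [CommRing S] {T : Cx S}

lemma isKProjective (hT : IsPerfectCx T) : T.IsKProjective := by
  obtain ⟨a, b, _, _⟩ := hT.bounded
  have (n : ℤ) : Projective (T.X n) := by
    have := hT.projective n
    exact (IsProjective.iff_projective (R := S) (T.X n)).1 inferInstance
  exact CochainComplex.isKProjective_of_projective T b

/-- In degree `n` this complex is the dual of `T^{m-n}`, so bounds `a`, `b` turn into `m - b`, `m -
a`. -/
lemma homCx (hT : IsPerfectCx T) {L : Cx S} {m : ℤ} (hL : ∀ i, i ≠ m → Limits.IsZero (L.X i))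
    (l : L.X m ≃ₗ[S] S) : IsPerfectCx (homCx T L) := by
  have e (n : ℤ) : (RelDual.homCx T L).X n ≃ₗ[S] Module.Dual S (T.X (m - n)) :=
    (cochainEquiv hL T (show (m - n) + n = m by lia)).trans (LinearEquiv.congrRight l)
  obtain ⟨a, b, ha, hb⟩ := hT.bounded
  have h (n : ℤ) := hT.finite n
  have h' (n : ℤ) := hT.projective n
  refine ⟨fun n => Module.Finite.equiv (e n).symm, fun n => Module.Projective.of_equiv (e n).symm,
    m - b, m - a, ?_, ?_⟩
  · rw [CochainComplex.isStrictlyGE_iff]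
    intro i hi
    have := ModuleCat.subsingleton_of_isZero (T.isZero_of_isStrictlyLE b (m - i) (by lia))
    have := (e i).toEquiv.subsingleton
    exact ModuleCat.isZero_of_subsingleton _
  · rw [CochainComplex.isStrictlyLE_iff]
    intro i hi
    have := ModuleCat.subsingleton_of_isZero (T.isZero_of_isStrictlyGE a (m - i) (by lia))
    have := (e i).toEquiv.subsingleton
    exact ModuleCat.isZero_of_subsingleton _

end IsPerfectCx

/-! ### Biduality and homothety up to quasi-isomorphism -/

section

variable {S : Type u} [CommRing S]

/-- Biduality holds for complexes quasi-isomorphic to perfect complexes, with respect to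
a K-injective complex quasi-isomorphic to a shift of the ring. -/
lemma quasiIso_biduality_of_perfect {L I : Cx S} {m : ℤ}
    (hL : ∀ i, i ≠ m → Limits.IsZero (L.X i)) (l : L.X m ≃ₗ[S] S) (ℓ : L ⟶ I) [QuasiIso ℓ]
    [I.IsKInjective] {T N : Cx S} (hT : IsPerfectCx T) (t : T ⟶ N) [QuasiIso t] :
    QuasiIso (biduality N I) := by
  have := hT.isKProjective
  have := (hT.homCx hL l).isKProjective
  have := hT.finite
  have := hT.projective
  have h₁ : QuasiIso (biduality T L) := quasiIso_of_bijective _ (bijective_biduality hL l T)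
  -- `L` need not be K-injective: replacing it by `I` is harmless because `T` and its dual are both
  -- K-projective.
  have h₂ : QuasiIso (mapRight (homCx T L) ℓ) := quasiIso_mapRight_of_isKProjective _ ℓ
  have h₃ : QuasiIso (mapRight T ℓ) := quasiIso_mapRight_of_isKProjective _ ℓ
  have h₄ : QuasiIso (mapLeft (mapRight T ℓ) I) := quasiIso_mapLeft _ I
  have h₅ : QuasiIso (biduality T I) := by
    have : QuasiIso (biduality T I ≫ mapLeft (mapRight T ℓ) I) := by
      rw [← biduality_mapRight]
      infer_instance
    exact quasiIso_of_comp_right _ (mapLeft (mapRight T ℓ) I)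
  have h₆ : QuasiIso (mapLeft t I) := quasiIso_mapLeft t I
  have h₇ : QuasiIso (mapLeft (mapLeft t I) I) := quasiIso_mapLeft _ I
  -- `I` is K-injective, so naturality along `t` moves the result from `T` to `N`.
  have : QuasiIso (t ≫ biduality N I) := by
    rw [biduality_naturality]
    infer_instance
  exact quasiIso_of_comp_left t _

/-- Biduality only depends on the K-injective complex up to quasi-isomorphism. -/
lemma quasiIso_biduality_of_quasiIso (M : Cx S) {J J' : Cx S} (φ : J ⟶ J') [QuasiIso φ]
    [J.IsKInjective] [J'.IsKInjective] [QuasiIso (biduality M J)] :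
    QuasiIso (biduality M J') := by
  have h₁ : QuasiIso (mapRight (homCx M J) φ) := quasiIso_mapRight_of_isKInjective _ φ
  have h₂ : QuasiIso (mapRight M φ) := quasiIso_mapRight_of_isKInjective _ φ
  have h₃ : QuasiIso (mapLeft (mapRight M φ) J') := quasiIso_mapLeft _ J'
  have : QuasiIso (biduality M J' ≫ mapLeft (mapRight M φ) J') := by
    rw [← biduality_mapRight]
    infer_instance
  exact quasiIso_of_comp_right _ (mapLeft (mapRight M φ) J')

/-! ### Homothety -/

/-- The generator of the complex `S` concentrated in degree zero. -/
def sglOne (S : Type u) [CommRing S] : (sgl S (ModuleCat.of S S)).X 0 :=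
  (HomologicalComplex.singleObjXSelf (ComplexShape.up ℤ) 0 (ModuleCat.of S S)).inv (1 : S)

/-- Evaluation at one, `Hom(S, J) → J`. -/
def evalOne (J : Cx S) : homCx (sgl S (ModuleCat.of S S)) J ⟶ J where
  f n := ModuleCat.ofHom
    { toFun := fun f : Cochain (sgl S (ModuleCat.of S S)) J n =>
        (f.v 0 n (zero_add n)).hom (sglOne S)
      map_add' := fun f g => by simp
      map_smul' := fun s f => by simp }
  comm' i j hij := by
    have hij : i + 1 = j := hij
    refine ModuleCat.hom_ext <| LinearMap.ext fun (f : Cochain (sgl S (ModuleCat.of S S)) J i) => ?_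
    change J.d i j ((f.v 0 i (zero_add i)).hom (sglOne S)) =
      ((δ i j f).v 0 j (zero_add j)).hom (sglOne S)
    rw [δ_v i j hij f 0 j (zero_add j) i 1 (by lia) rfl]
    simp

lemma quasiIso_evalOne (J : Cx S) : QuasiIso (evalOne J) := by
  refine quasiIso_of_bijective _ fun n => ?_
  let e := Cochain.fromSingleEquiv (X := ModuleCat.of S S) (K := J) (zero_add n)
  have key (f : Cochain (sgl S (ModuleCat.of S S)) J n) :
      (evalOne J).f n f = (e f).hom (1 : S) := rfl
  constructor
  · intro f g hfg
    refine e.injective (ModuleCat.hom_ext (LinearMap.ext_ring ?_))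
    exact hfg
  · intro y
    refine ⟨e.symm (ModuleCat.ofHom (LinearMap.toSpanSingleton S _ y)), ?_⟩
    refine (key _).trans ?_
    rw [e.apply_symm_apply]
    simp

lemma sgl_hom_ext {A : Cx S} {f g : sgl S (ModuleCat.of S S) ⟶ A}
    (h : f.f 0 (sglOne S) = g.f 0 (sglOne S)) : f = g := by
  refine HomologicalComplex.from_single_hom_ext ?_
  rw [← cancel_epi (HomologicalComplex.singleObjXSelf (ComplexShape.up ℤ) 0 (ModuleCat.of S S)).inv]
  exact ModuleCat.hom_ext (LinearMap.ext_ring h)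

lemma homothety_sglOne {M N : Cx S} (ι : M ⟶ N) :
    (homothety ι).f 0 (sglOne S) = Cochain.ofHom ι := by
  have h : (homothety ι).f 0 =
      (HomologicalComplex.singleObjXSelf (ComplexShape.up ℤ) 0 (ModuleCat.of S S)).hom ≫
      (ModuleCat.ofHom (LinearMap.toSpanSingleton S (Cochain M N 0) (Cochain.ofHom ι)) :
        ModuleCat.of S S ⟶ (homCx M N).X 0) := HomologicalComplex.mkHomFromSingle_f _ _
  rw [h]
  have h2 : (HomologicalComplex.singleObjXSelf (ComplexShape.up ℤ) 0 (ModuleCat.of S S)).hom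
      (sglOne S) = (1 : S) :=
    congr($((HomologicalComplex.singleObjXSelf (ComplexShape.up ℤ) 0
      (ModuleCat.of S S)).inv_hom_id) (1 : S))
  refine (congrArg (LinearMap.toSpanSingleton S (Cochain M N 0) (Cochain.ofHom ι)) h2).trans ?_
  simp

lemma homothety_eq {M N : Cx S} (ι : M ⟶ N) : homothety ι = homothety (𝟙 N) ≫ mapLeft ι N := by
  refine sgl_hom_ext ((homothety_sglOne ι).trans ?_)
  have h : (homothety (𝟙 N) ≫ mapLeft ι N).f 0 (sglOne S) =
      (mapLeft ι N).f 0 ((homothety (𝟙 N)).f 0 (sglOne S)) := rfl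
  rw [h, homothety_sglOne]
  exact (Cochain.comp_id (Cochain.ofHom ι)).symm

/-- Under `Hom(S, J) ≅ J`, multiplication by `s` is evaluation at `s`; no sign appears because `s`
has degree zero. Thus the homothety statement becomes biduality for the ring. -/
lemma homothety_id_mapLeft (J : Cx S) :
    homothety (𝟙 J) ≫ mapLeft (evalOne J) J = biduality (sgl S (ModuleCat.of S S)) J := by
  refine sgl_hom_ext ?_
  have h : (homothety (𝟙 J) ≫ mapLeft (evalOne J) J).f 0 (sglOne S) =
      (mapLeft (evalOne J) J).f 0 ((homothety (𝟙 J)).f 0 (sglOne S)) := rfl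
  rw [h, homothety_sglOne]
  change (Cochain.ofHom (evalOne J)).comp (Cochain.ofHom (𝟙 J)) (zero_add 0) =
    evalCochain (sgl S (ModuleCat.of S S)) J 0 (sglOne S)
  rw [Cochain.comp_id]
  refine Cochain.ext _ _ fun n q hnq => ModuleCat.hom_ext <| LinearMap.ext fun
    (f : Cochain (sgl S (ModuleCat.of S S)) J n) => ?_
  obtain rfl : n = q := by lia
  rw [Cochain.ofHom_v]
  refine Eq.trans ?_ (evalCochain_apply (sgl S (ModuleCat.of S S)) J 0 (sglOne S) n n hnq f).symm
  rw [mul_zero, Int.negOnePow_zero, one_smul]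
  rfl

/-- The homothety morphism is a quasi-isomorphism if biduality holds for the ring. -/
lemma quasiIso_homothety {N J : Cx S} (ι : N ⟶ J) [QuasiIso ι] [J.IsKInjective]
    [QuasiIso (biduality (sgl S (ModuleCat.of S S)) J)] : QuasiIso (homothety ι) := by
  have h₀ := quasiIso_evalOne J
  have h₁ : QuasiIso (mapLeft (evalOne J) J) := quasiIso_mapLeft _ J
  have h₂ : QuasiIso (mapLeft ι J) := quasiIso_mapLeft _ J
  have h₃ : QuasiIso (homothety (𝟙 J)) := by
    have : QuasiIso (homothety (𝟙 J) ≫ mapLeft (evalOne J) J) := by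
      rw [homothety_id_mapLeft]
      infer_instance
    exact quasiIso_of_comp_right _ (mapLeft (evalOne J) J)
  rw [homothety_eq]
  infer_instance

end

/-! ### Reduction of duality over `S` to duality over `Q` -/

section ChangeOfRings

variable {Q S : Type u} [CommRing Q] [CommRing S] (π : Q →+* S)

/-- Restriction of scalars for complexes. -/
abbrev resCx : Cx S ⥤ Cx Q :=
  (ModuleCat.restrictScalars.{u} π).mapHomologicalComplex (ComplexShape.up ℤ)

/-- Coextension of scalars for complexes. -/
abbrev coextCx : Cx Q ⥤ Cx S :=
  (ModuleCat.coextendScalars.{u} π).mapHomologicalComplex (ComplexShape.up ℤ)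

lemma quasiIso_resCx_map_iff {A B : Cx S} (f : A ⟶ B) : QuasiIso ((resCx π).map f) ↔ QuasiIso f :=
  HomologicalComplex.quasiIso_map_iff_of_preservesHomology f (ModuleCat.restrictScalars.{u} π)

/-- Evaluation of an element of a coextended module. -/
def coextApply {X : ModuleCat.{u} Q} (g : (ModuleCat.coextendScalars.{u} π).obj X) (s : S) : X :=
  ModuleCat.CoextendScalars.equiv π X g s

open ModuleCat.RestrictionCoextensionAdj in
lemma toRestriction_bijective {Y : ModuleCat.{u} S} {X : ModuleCat.{u} Q} :
    Function.Bijective (HomEquiv.toRestriction π :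
      (Y ⟶ (ModuleCat.coextendScalars π).obj X) → _) :=
  ((ModuleCat.restrictCoextendScalarsAdj.{u} π).homEquiv Y X).symm.bijective

open ModuleCat.RestrictionCoextensionAdj in
/-- The adjunction isomorphism `Hom_S(M, Hom_Q(S, I)) ≅ Hom_Q(M, I)`. -/
def homAdj (M : Cx S) (I : Cx Q) :
    (resCx π).obj (homCx M ((coextCx π).obj I)) ⟶ homCx ((resCx π).obj M) I where
  f n := ModuleCat.ofHom
      (X := (ModuleCat.restrictScalars π).obj ((homCx M ((coextCx π).obj I)).X n))
      (Y := Cochain ((resCx π).obj M) I n)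
    { toFun := fun f : Cochain M ((coextCx π).obj I) n =>
        (Cochain.mk fun p q h => HomEquiv.toRestriction π (f.v p q h) :
          Cochain ((resCx π).obj M) I n)
      map_add' := fun f g => by
        ext p q h x
        rfl
      map_smul' := fun r (f : Cochain M ((coextCx π).obj I) n) => by
        ext p q h x
        change coextApply π (X := I.X q) ((f.v p q h).hom x) (1 * π r) =
          r • coextApply π (X := I.X q) ((f.v p q h).hom x) 1
        rw [mul_comm]
        exact map_smul (ModuleCat.CoextendScalars.equiv π (I.X q) ((f.v p q h).hom x)) r
          (show (ModuleCat.restrictScalars π).obj (ModuleCat.of S S) from (1 : S)) }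
  comm' i j hij := by
    have hij : i + 1 = j := hij
    refine ModuleCat.hom_ext <| LinearMap.ext fun (f : Cochain M ((coextCx π).obj I) i) => ?_
    change δ i j (Cochain.mk fun p q h => HomEquiv.toRestriction π (f.v p q h) :
        Cochain ((resCx π).obj M) I i) =
      (Cochain.mk fun p q h => HomEquiv.toRestriction π ((δ i j f).v p q h) :
        Cochain ((resCx π).obj M) I j)
    ext p q h x
    rw [δ_v i j hij _ p q h (q - 1) (p + 1) rfl rfl]
    change _ = coextApply π (X := I.X q) (((δ i j f).v p q h).hom x) 1
    rw [δ_v i j hij f p q h (q - 1) (p + 1) rfl rfl]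
    rcases Int.even_or_odd j with hj | hj
    · rw [Int.negOnePow_even _ hj, one_smul, one_smul]
      rfl
    · rw [Int.negOnePow_odd _ hj, Units.neg_smul, Units.neg_smul, one_smul, one_smul]
      rfl

lemma bijective_homAdj (M : Cx S) (I : Cx Q) (n : ℤ) :
    Function.Bijective ((homAdj π M I).f n) := by
  constructor
  · intro f g hfg
    refine Cochain.ext _ _ fun p q h => (toRestriction_bijective π).1 ?_
    exact congr(Cochain.v (show Cochain ((resCx π).obj M) I n from $hfg) p q h)
  · intro c
    choose g hg using fun p q (h : p + n = q) =>
      (toRestriction_bijective π).2 (Cochain.v (show Cochain ((resCx π).obj M) I n from c) p q h)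
    refine ⟨(Cochain.mk g : Cochain M ((coextCx π).obj I) n), ?_⟩
    refine Cochain.ext _ _ fun p q h => ?_
    exact hg p q h

lemma quasiIso_homAdj (M : Cx S) (I : Cx Q) : QuasiIso (homAdj π M I) :=
  quasiIso_of_bijective _ (bijective_homAdj π M I)

-- Both composites send `x` to the functional taking `f` to the value of `f(x)` at `1 : S`, with the
-- same sign.
open ModuleCat.RestrictionCoextensionAdj in
lemma biduality_homAdj (M : Cx S) (I : Cx Q) :
    (resCx π).map (biduality M ((coextCx π).obj I)) ≫ homAdj π (homCx M ((coextCx π).obj I)) I =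
      biduality ((resCx π).obj M) I ≫ mapLeft (homAdj π M I) I := by
  refine HomologicalComplex.hom_ext _ _ fun p => ModuleCat.hom_ext <|
    LinearMap.ext fun (x : M.X p) => ?_
  refine Cochain.ext _ _ fun n q h => ModuleCat.hom_ext <| LinearMap.ext fun
    (f : Cochain M ((coextCx π).obj I) n) => ?_
  have hpq : p + n = q := by rw [add_comm]; exact h
  change coextApply π (X := I.X q) (((evalCochain M ((coextCx π).obj I) p x).v n q h).hom f) 1 =
    (((Cochain.ofHom (homAdj π M I)).comp (evalCochain ((resCx π).obj M) I p x)
      (zero_add p)).v n q h).hom f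
  rw [Cochain.zero_cochain_comp_v, Cochain.ofHom_v]
  change coextApply π (X := I.X q) ((n * p).negOnePow • (f.v p q hpq).hom x) 1 =
    (n * p).negOnePow • coextApply π (X := I.X q) ((f.v p q hpq).hom x) 1
  rcases Int.even_or_odd (n * p) with hj | hj
  · rw [Int.negOnePow_even _ hj, one_smul, one_smul]
  · rw [Int.negOnePow_odd _ hj, Units.neg_smul, Units.neg_smul, one_smul, one_smul]
    rfl

/-- Biduality over `S` with respect to a coextended complex reduces to biduality over `Q`. -/
lemma quasiIso_biduality_coextCx (M : Cx S) (I : Cx Q) [I.IsKInjective]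
    [QuasiIso (biduality ((resCx π).obj M) I)] :
    QuasiIso (biduality M ((coextCx π).obj I)) := by
  have h₁ := quasiIso_homAdj π M I
  have h₂ := quasiIso_homAdj π (homCx M ((coextCx π).obj I)) I
  have h₃ : QuasiIso (mapLeft (homAdj π M I) I) := quasiIso_mapLeft _ I
  rw [← quasiIso_resCx_map_iff π]
  have : QuasiIso ((resCx π).map (biduality M ((coextCx π).obj I)) ≫
      homAdj π (homCx M ((coextCx π).obj I)) I) := by
    rw [biduality_homAdj]
    infer_instance
  exact quasiIso_of_comp_right _ (homAdj π (homCx M ((coextCx π).obj I)) I)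

end ChangeOfRings

/-! ### Flatness, purity and character modules -/

section Flatness

variable {R : Type u} [CommRing R]

/-- A quotient of a flat module by a pure submodule is flat. -/
lemma flat_of_forall_lTensor_injective {A F B : Type u} [AddCommGroup A] [AddCommGroup F]
    [AddCommGroup B] [Module R A] [Module R F] [Module R B] [Module.Flat R F] (f : A →ₗ[R] F)
    (g : F →ₗ[R] B) (hg : Function.Surjective g) (hfg : Function.Exact f g)
    (h : ∀ (X : Type u) [AddCommGroup X] [Module R X], Function.Injective (f.lTensor X)) :
    Module.Flat R B := by
  rw [Module.Flat.iff_rTensor_injective']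
  intro I
  rw [injective_iff_map_eq_zero]
  intro z hz
  obtain ⟨w, rfl⟩ := LinearMap.lTensor_surjective I hg z
  have h₁ : g.lTensor R (I.subtype.rTensor F w) = 0 := by
    rw [← LinearMap.comp_apply, LinearMap.lTensor_comp_rTensor, ← LinearMap.rTensor_comp_lTensor]
    exact hz
  obtain ⟨v, hv⟩ := (lTensor_exact R hfg hg _).1 h₁
  have hI := rTensor_exact A (LinearMap.exact_subtype_mkQ I) (Submodule.mkQ_surjective I)
  have hI' := rTensor_exact F (LinearMap.exact_subtype_mkQ I) (Submodule.mkQ_surjective I)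
  -- Purity is needed only for the test module `R ⧸ I`: it forces `v` to come from `I ⊗ A`, so that
  -- `w`, and with it the class in `I ⊗ B`, can be corrected to zero.
  have h₂ : (Submodule.mkQ I).rTensor A v = 0 := by
    refine h (R ⧸ I) ?_
    rw [map_zero, ← LinearMap.comp_apply, LinearMap.lTensor_comp_rTensor,
      ← LinearMap.rTensor_comp_lTensor, LinearMap.comp_apply, hv]
    exact hI'.apply_apply_eq_zero w
  obtain ⟨t, rfl⟩ := (hI v).1 h₂
  have h₃ : f.lTensor I t = w := by
    refine Module.Flat.rTensor_preserves_injective_linearMap I.subtype I.subtype_injective ?_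
    rw [← hv, ← LinearMap.comp_apply, LinearMap.rTensor_comp_lTensor,
      ← LinearMap.lTensor_comp_rTensor, LinearMap.comp_apply]
  rw [← h₃]
  exact (lTensor_exact I hfg hg).apply_apply_eq_zero t

/-- Submodules of flat modules with flat quotient are flat. -/
lemma flat_of_exact_of_flat {A F B : Type u} [AddCommGroup A] [AddCommGroup F]
    [AddCommGroup B] [Module R A] [Module R F] [Module R B] [Module.Flat R F] [Module.Flat R B]
    (f : A →ₗ[R] F) (g : F →ₗ[R] B) (hf : Function.Injective f) (hg : Function.Surjective g)
    (hfg : Function.Exact f g) : Module.Flat R A := by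
  rw [Module.Flat.iff_rTensor_injective']
  intro I
  have h := LinearMap.lTensor_injective_of_exact_of_flat g hg f hf hfg I
  have h₂ := Module.Flat.rTensor_preserves_injective_linearMap (M := F) I.subtype
    I.subtype_injective
  have h₃ := h₂.comp h
  rw [← LinearMap.coe_comp, LinearMap.rTensor_comp_lTensor, ← LinearMap.lTensor_comp_rTensor,
    LinearMap.coe_comp] at h₃
  exact h₃.of_comp

/-- If `A → F` is injective with flat cokernel, then maps from `A` to a character module extend
to `F`. -/
lemma exists_extension_char {A F B : Type u} [AddCommGroup A] [AddCommGroup F]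
    [AddCommGroup B] [Module R A] [Module R F] [Module R B] [Module.Flat R B]
    (f : A →ₗ[R] F) (g : F →ₗ[R] B) (hf : Function.Injective f) (hg : Function.Surjective g)
    (hfg : Function.Exact f g) (X : Type u) [AddCommGroup X] [Module R X]
    (γ : A →ₗ[R] CharacterModule X) : ∃ h : F →ₗ[R] CharacterModule X, h ∘ₗ f = γ := by
  have h := LinearMap.lTensor_injective_of_exact_of_flat g hg f hf hfg X
  -- Maps into the character module of `X` are characters of the tensor product with `X`, so
  -- injectivity after tensoring is the same as extendability.
  rw [LinearMap.lTensor_inj_iff_rTensor_inj, rTensor_injective_iff_lcomp_surjective] at h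
  exact h γ

end Flatness

open DerivedCategory Pretriangulated

/-! ### Flatness of modules detected by Ext into character modules -/

section Vanishing

variable {R : Type u} [CommRing R]

/-- The object of the derived category given by a module in degree `n`. -/
abbrev sglD (n : ℤ) (Y : ModuleCat.{u} R) : D R := (singleFunctor (ModuleCat.{u} R) n).obj Y

/-- `Ext^i(N, Y) = 0` for `i > n`. -/
def HomVanish (N : D R) (Y : ModuleCat.{u} R) (n : ℤ) : Prop :=
  ∀ i : ℤ, n < i → ∀ f : N ⟶ (sglD 0 Y)⟦i⟧, f = 0

lemma HomVanish.of_iso {N N' : D R} {Y : ModuleCat.{u} R} {n : ℤ} (h : HomVanish N Y n)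
    (e : N' ≅ N) : HomVanish N' Y n := fun i hi f => by
  rw [← cancel_epi e.inv, h i hi (e.inv ≫ f), Limits.comp_zero]

lemma HomVanish.mono {N : D R} {Y : ModuleCat.{u} R} {n m : ℤ} (h : HomVanish N Y n)
    (hnm : n ≤ m) : HomVanish N Y m := fun i hi f => h i (by lia) f

lemma shift_hom_eq_zero {N Y : D R} (k i j : ℤ) (hij : j + k = i) (h : ∀ g : N ⟶ Y⟦j⟧, g = 0)
    (f : N⟦k⟧ ⟶ Y⟦i⟧) : f = 0 := by
  let e := (shiftFunctorAdd' (D R) j k i hij).app Y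
  obtain ⟨g, hg⟩ := (shiftFunctor (D R) k).map_surjective (f ≫ e.hom)
  rw [← cancel_mono e.hom, ← hg, h g, Functor.map_zero, Limits.zero_comp]

lemma HomVanish.shift {N : D R} {Y : ModuleCat.{u} R} {n : ℤ} (h : HomVanish N Y n) (k m : ℤ)
    (hm : m = n + k) : HomVanish (N⟦k⟧) Y m := fun i hi =>
  shift_hom_eq_zero k i (i - k) (by lia) (h (i - k) (by lia))

lemma HomVanish.obj₂ {T : Triangle (D R)} (hT : T ∈ distTriang _) {Y : ModuleCat.{u} R} {n : ℤ}
    (h₁ : HomVanish T.obj₁ Y n) (h₃ : HomVanish T.obj₃ Y n) : HomVanish T.obj₂ Y n :=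
  fun i hi f => by
    obtain ⟨g, rfl⟩ := Triangle.yoneda_exact₂ T hT f (h₁ i hi _)
    rw [h₃ i hi g, Limits.comp_zero]

/-- A morphism from the third vertex that dies on the second factors through the shift of the first,
which raises the first bound by one. -/
lemma HomVanish.obj₃ {T : Triangle (D R)} (hT : T ∈ distTriang _) {Y : ModuleCat.{u} R} {n : ℤ}
    (h₁ : HomVanish T.obj₁ Y (n - 1)) (h₂ : HomVanish T.obj₂ Y n) : HomVanish T.obj₃ Y n :=
  fun i hi f => by
    obtain ⟨g, rfl⟩ := Triangle.yoneda_exact₃ T hT f (h₂ i hi _)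
    rw [h₁.shift 1 n (by lia) i hi g, Limits.comp_zero]

/-- Morphisms in the derived category from a K-projective complex are given by morphisms of
complexes. -/
lemma exists_Q_map_of_isKProjective {T L : Cx R} [T.IsKProjective] (f : toD T ⟶ toD L) :
    ∃ g : T ⟶ L, Q.map g = f := by
  obtain ⟨g, hg⟩ := (CochainComplex.IsKProjective.Qh_map_bijective T
    ((HomotopyCategory.quotient _ _).obj L)).2
      ((quotientCompQhIso _).hom.app T ≫ f ≫ (quotientCompQhIso _).inv.app L)
  obtain ⟨g, rfl⟩ := (HomotopyCategory.quotient _ _).map_surjective g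
  refine ⟨g, ?_⟩
  rw [← cancel_mono ((quotientCompQhIso _).inv.app L), quotientCompQhIso_inv_naturality, hg,
    Iso.inv_hom_id_app_assoc]

lemma homVanish_of_projective (F : ModuleCat.{u} R) [Projective F] (Y : ModuleCat.{u} R) :
    HomVanish (sglD 0 F) Y 0 := fun i hi f => by
  have (n : ℤ) : Projective (((CochainComplex.singleFunctor (ModuleCat.{u} R) 0).obj F).X n) := by
    by_cases h : n = 0
    · subst h
      exact Projective.of_iso (HomologicalComplex.singleObjXSelf (ComplexShape.up ℤ) 0 F).symm
        inferInstance
    · exact (HomologicalComplex.isZero_single_obj_X (ComplexShape.up ℤ) 0 F n h).projective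
  have := CochainComplex.isKProjective_of_projective
    ((CochainComplex.singleFunctor (ModuleCat.{u} R) 0).obj F) 0
  let e := (singleFunctorIsoCompQ (ModuleCat.{u} R) 0).app F
  let e' : (sglD 0 Y)⟦i⟧ ≅ toD ((sgl R Y)⟦i⟧) :=
    (shiftFunctor (D R) i).mapIso ((singleFunctorIsoCompQ (ModuleCat.{u} R) 0).app Y) ≪≫
      (Q.commShiftIso i).symm.app (sgl R Y)
  obtain ⟨g, hg⟩ := exists_Q_map_of_isKProjective (e.inv ≫ f ≫ e'.hom)
  -- The source lives in degree `0` and the target in degree `-i`, which is nonzero.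
  have hg0 : g = 0 := by
    refine HomologicalComplex.from_single_hom_ext ?_
    exact (HomologicalComplex.isZero_single_obj_X (ComplexShape.up ℤ) 0 Y (0 + i)
      (by lia)).eq_of_tgt _ _
  rw [← cancel_epi e.inv, ← cancel_mono e'.hom, Category.assoc, ← hg, hg0, Functor.map_zero,
    Limits.comp_zero, Limits.zero_comp]

/-- The canonical presentation of a module by a free module. -/
abbrev presentation (B : ModuleCat.{u} R) : (B →₀ R) →ₗ[R] B := Finsupp.linearCombination R id

lemma presentation_surjective (B : ModuleCat.{u} R) : Function.Surjective (presentation B) :=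
  Finsupp.linearCombination_id_surjective R B

lemma presentation_shortExact (B : ModuleCat.{u} R) :
    (LinearMap.shortComplexKer (presentation B)).ShortExact :=
  LinearMap.shortExact_shortComplexKer (presentation_surjective B)

lemma homVanish_presentation (B : ModuleCat.{u} R) (Y : ModuleCat.{u} R) :
    HomVanish (sglD 0 (LinearMap.shortComplexKer (presentation B)).X₂) Y 0 :=
  have : Projective (LinearMap.shortComplexKer (presentation B)).X₂ :=
    inferInstanceAs (Projective (ModuleCat.of R (B →₀ R)))
  homVanish_of_projective _ Y

section ShortExact

variable {S : ShortComplex (ModuleCat.{u} R)} (hS : S.ShortExact)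
include hS

lemma exists_singleδ_comp {Y : D R} (f : sglD 0 S.X₃ ⟶ Y)
    (h : (singleFunctor _ 0).map S.g ≫ f = 0) :
    ∃ g : (sglD 0 S.X₁)⟦(1 : ℤ)⟧ ⟶ Y, f = hS.singleδ ≫ g :=
  Triangle.yoneda_exact₃ _ hS.singleTriangle_distinguished f h

lemma singleδ_comp_shift_map :
    hS.singleδ ≫ ((singleFunctor (ModuleCat.{u} R) 0).map S.f)⟦(1 : ℤ)⟧' = 0 :=
  comp_distTriang_mor_zero₃₁ _ hS.singleTriangle_distinguished

/-- The composite of the connecting class with `f⟦1⟧` is the obstruction to extending `f` along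
`S.f`. The sign in the witness comes from rotating the triangle. -/
lemma exists_map_comp {Y : D R} (f : sglD 0 S.X₁ ⟶ Y) (h : hS.singleδ ≫ f⟦(1 : ℤ)⟧' = 0) :
    ∃ g : sglD 0 S.X₂ ⟶ Y, f = (singleFunctor _ 0).map S.f ≫ g := by
  obtain ⟨g, hg⟩ : ∃ g : (sglD 0 S.X₂)⟦(1 : ℤ)⟧ ⟶ Y⟦(1 : ℤ)⟧, f⟦(1 : ℤ)⟧' =
      (-((singleFunctor (ModuleCat.{u} R) 0).map S.f)⟦(1 : ℤ)⟧') ≫ g :=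
    Triangle.yoneda_exact₃ _ (rot_of_distTriang _ hS.singleTriangle_distinguished) _ h
  obtain ⟨g, rfl⟩ := (shiftFunctor (D R) (1 : ℤ)).map_surjective g
  refine ⟨-g, (shiftFunctor (D R) (1 : ℤ)).map_injective ?_⟩
  rw [hg]
  simp

end ShortExact

instance (B : ModuleCat.{u} R) :
    Module.Flat R (LinearMap.shortComplexKer (presentation B)).X₂ :=
  inferInstanceAs (Module.Flat R (B →₀ R))

/-- Flat modules have no higher extensions by character modules. -/
lemma homVanish_char_of_flat (B : ModuleCat.{u} R) [Module.Flat R B] (X : ModuleCat.{u} R) :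
    HomVanish (sglD 0 B) (ModuleCat.of R (CharacterModule X)) 0 := by
  suffices h : ∀ (n : ℕ) (B : ModuleCat.{u} R) [Module.Flat R B] (i : ℤ) (_ : i = n + 1)
      (f : sglD 0 B ⟶ (sglD 0 (ModuleCat.of R (CharacterModule X)))⟦i⟧), f = 0 by
    intro i hi f
    exact h (i - 1).toNat B i (by lia) f
  intro n
  induction n with
  | zero =>
    intro B _ i hi f
    obtain rfl : i = 1 := by simpa using hi
    have hS := presentation_shortExact B
    obtain ⟨g, rfl⟩ := exists_singleδ_comp hS f (homVanish_presentation B _ _ (by simp) _)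
    obtain ⟨g, rfl⟩ := (shiftFunctor (D R) (1 : ℤ)).map_surjective g
    obtain ⟨γ, rfl⟩ := (singleFunctor (ModuleCat.{u} R) 0).map_surjective g
    have : Module.Flat R (LinearMap.shortComplexKer (presentation B)).X₃ :=
      inferInstanceAs (Module.Flat R B)
    -- An `Ext¹` class is given by a map `γ` on the first syzygy; it vanishes once `γ` extends to
    -- the free module.
    obtain ⟨h, hh⟩ := exists_extension_char _ _ hS.moduleCat_injective_f hS.moduleCat_surjective_g
      ((ShortComplex.ShortExact.moduleCat_exact_iff_function_exact _).1 hS.exact) X γ.hom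
    have hγ : γ = (LinearMap.shortComplexKer (presentation B)).f ≫ ModuleCat.ofHom h :=
      ModuleCat.hom_ext hh.symm
    rw [hγ, Functor.map_comp, Functor.map_comp, ← Category.assoc, singleδ_comp_shift_map hS,
      Limits.zero_comp]
  | succ n ih =>
    intro B _ i hi f
    have hS := presentation_shortExact B
    obtain ⟨g, rfl⟩ := exists_singleδ_comp hS f (homVanish_presentation B _ _ (by lia) _)
    have : Module.Flat R (LinearMap.shortComplexKer (presentation B)).X₃ :=
      inferInstanceAs (Module.Flat R B)
    -- Dimension shifting: the syzygy is again flat, so the induction hypothesis applies to it.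
    have := flat_of_exact_of_flat _ _ hS.moduleCat_injective_f hS.moduleCat_surjective_g
      ((ShortComplex.ShortExact.moduleCat_exact_iff_function_exact _).1 hS.exact)
    rw [shift_hom_eq_zero 1 i (n + 1) (by lia) (ih _ _ rfl) g, Limits.comp_zero]

/-- Only `Ext¹` is used: its vanishing extends every map from the syzygy to a character module,
which makes the syzygy a pure submodule of a free module. -/
lemma flat_of_homVanish (B : ModuleCat.{u} R)
    (h : ∀ X : ModuleCat.{u} R, HomVanish (sglD 0 B) (ModuleCat.of R (CharacterModule X)) 0) :
    Module.Flat R B := by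
  have hS := presentation_shortExact B
  refine flat_of_forall_lTensor_injective _ _ hS.moduleCat_surjective_g
    ((ShortComplex.ShortExact.moduleCat_exact_iff_function_exact _).1 hS.exact) fun X _ _ => ?_
  rw [LinearMap.lTensor_inj_iff_rTensor_inj, rTensor_injective_iff_lcomp_surjective]
  intro γ
  obtain ⟨g, hg⟩ := exists_map_comp hS
    ((singleFunctor _ 0).map (ModuleCat.ofHom γ : _ ⟶ ModuleCat.of R (CharacterModule X)))
    (h (ModuleCat.of R X) 1 (by simp) _)
  obtain ⟨g, rfl⟩ := (singleFunctor (ModuleCat.{u} R) 0).map_surjective g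
  rw [← Functor.map_comp] at hg
  exact ⟨g.hom, congr($((singleFunctor (ModuleCat.{u} R) 0).map_injective hg).hom).symm⟩

end Vanishing

/-! ### Ext amplitude of bounded flat complexes -/

section Vanishing

variable {R : Type u} [CommRing R]

/-- The module placed in degree `a` is a shift of the module placed in degree `0`. -/
def sglDShiftIso (a : ℤ) (Y : ModuleCat.{u} R) : (sglD 0 Y)⟦-a⟧ ≅ sglD a Y :=
  ((singleFunctors (ModuleCat.{u} R)).shiftIso (-a) a 0 (by lia)).app Y

lemma HomVanish.single {B Y : ModuleCat.{u} R} (h : HomVanish (sglD 0 B) Y 0) (a : ℤ) :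
    HomVanish (sglD a B) Y (-a) :=
  (h.shift (-a) (-a) (by lia)).of_iso (sglDShiftIso a B).symm

/-- The projection of a complex vanishing in degrees `< a` onto its term of degree `a`. -/
def toBottom (F : Cx R) (a : ℤ) [F.IsStrictlyGE a] :
    F ⟶ (CochainComplex.singleFunctor (ModuleCat.{u} R) a).obj (F.X a) :=
  HomologicalComplex.mkHomToSingle (𝟙 _) (fun i hi =>
    (F.isZero_of_isStrictlyGE a i (by have : i + 1 = a := hi; lia)).eq_of_src _ _)

instance isIso_toBottom (F : Cx R) (a : ℤ) [F.IsStrictlyGE a] : IsIso ((toBottom F a).f a) := by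
  rw [toBottom, HomologicalComplex.mkHomToSingle_f, Category.id_comp]
  exact (HomologicalComplex.singleObjXSelf (ComplexShape.up ℤ) a (F.X a)).isIso_inv

lemma isZero_single_X (a i : ℤ) (h : i ≠ a) (Y : ModuleCat.{u} R) :
    Limits.IsZero (((CochainComplex.singleFunctor (ModuleCat.{u} R) a).obj Y).X i) :=
  HomologicalComplex.isZero_single_obj_X (ComplexShape.up ℤ) a Y i h

instance epi_toBottom (F : Cx R) (a : ℤ) [F.IsStrictlyGE a] : Epi (toBottom F a) := by
  refine HomologicalComplex.epi_of_epi_f _ fun i => ?_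
  by_cases h : i = a
  · subst h
    infer_instance
  · exact ⟨fun _ _ _ => (isZero_single_X a i h _).eq_of_src _ _⟩

/-- The short exact sequence `0 → F' → F → F^a[-a] → 0`. -/
abbrev bottomSES (F : Cx R) (a : ℤ) [F.IsStrictlyGE a] : ShortComplex (Cx R) :=
  ShortComplex.mk (Limits.kernel.ι (toBottom F a)) (toBottom F a) (Limits.kernel.condition _)

lemma bottomSES_shortExact (F : Cx R) (a : ℤ) [F.IsStrictlyGE a] : (bottomSES F a).ShortExact where
  exact := ShortComplex.exact_of_f_is_kernel _ (Limits.kernelIsKernel _)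
  mono_f := inferInstanceAs (Mono (Limits.kernel.ι _))
  epi_g := epi_toBottom F a

lemma bottomSES_eval (F : Cx R) (a i : ℤ) [F.IsStrictlyGE a] :
    ((bottomSES F a).map (HomologicalComplex.eval _ _ i)).ShortExact :=
  (bottomSES_shortExact F a).map_of_exact _

lemma isZero_of_shortExact {C : Type*} [Category* C] [Abelian C] {S : ShortComplex C}
    (hS : S.ShortExact) (h : S.f = 0) : Limits.IsZero S.X₁ :=
  have := hS.mono_f
  Limits.IsZero.of_mono_eq_zero S.f h

lemma flat_of_isZero (M : ModuleCat.{u} R) (h : Limits.IsZero M) : Module.Flat R M :=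
  have := ModuleCat.subsingleton_of_isZero h
  inferInstance

/-- Bounded complexes of flat modules have finite amplitude. -/
lemma homVanish_of_flat (F : Cx R) (a b : ℤ) [F.IsStrictlyGE a] [F.IsStrictlyLE b]
    (hF : ∀ i, Module.Flat R (F.X i)) (X : ModuleCat.{u} R) :
    HomVanish (toD F) (ModuleCat.of R (CharacterModule X)) (-a) := by
  -- Induction on the number `n` of allowed degrees, splitting off the bottom term as a quotient; `n
  -- = 0` is the zero complex and also covers `b < a`.
  suffices h : ∀ (n : ℕ) (F : Cx R) (a : ℤ) [F.IsStrictlyGE a] [F.IsStrictlyLE (a + n - 1)]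
      (_ : ∀ i, Module.Flat R (F.X i)),
      HomVanish (toD F) (ModuleCat.of R (CharacterModule X)) (-a) by
    have : F.IsStrictlyLE (a + (b + 1 - a).toNat - 1) := F.isStrictlyLE_of_le b _ (by lia)
    exact h (b + 1 - a).toNat F a hF
  intro n
  induction n with
  | zero =>
    intro F a _ _ _ i _ f
    have hF : Limits.IsZero F := by
      rw [Limits.IsZero.iff_id_eq_zero]
      ext i : 1
      by_cases h : i < a
      · exact (F.isZero_of_isStrictlyGE a i h).eq_of_src _ _
      · exact (F.isZero_of_isStrictlyLE (a + (0 : ℕ) - 1) i (by simp; lia)).eq_of_src _ _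
    exact (Q.map_isZero hF).eq_of_src _ _
  | succ n ih =>
    intro F a _ _ hF
    have hflat (i : ℤ) : Module.Flat R
        (((CochainComplex.singleFunctor (ModuleCat.{u} R) a).obj (F.X a)).X i) := by
      by_cases h : i = a
      · subst h
        exact Module.Flat.of_linearEquiv (HomologicalComplex.singleObjXSelf (ComplexShape.up ℤ) i
          (F.X i)).toLinearEquiv
      · exact flat_of_isZero _ (isZero_single_X a i h _)
    let F' : Cx R := Limits.kernel (toBottom F a)
    have h₁ : F'.IsStrictlyGE (a + 1) := by
      rw [CochainComplex.isStrictlyGE_iff]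
      intro i hi
      refine isZero_of_shortExact (bottomSES_eval F a i) ?_
      by_cases h : i = a
      · subst h
        exact (cancel_mono ((toBottom F i).f i)).1
          (((bottomSES F i).map (HomologicalComplex.eval _ _ i)).zero.trans Limits.zero_comp.symm)
      · exact (F.isZero_of_isStrictlyGE a i (by lia)).eq_of_tgt _ _
    have h₂ : F'.IsStrictlyLE (a + 1 + n - 1) := by
      rw [CochainComplex.isStrictlyLE_iff]
      intro i hi
      exact isZero_of_shortExact (bottomSES_eval F a i)
        ((F.isZero_of_isStrictlyLE (a + (n + 1 : ℕ) - 1) i (by push_cast; lia)).eq_of_tgt _ _)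
    have h₃ (i : ℤ) : Module.Flat R (F'.X i) := by
      have hS := bottomSES_eval F a i
      have : Module.Flat R ((bottomSES F a).map (HomologicalComplex.eval _ _ i)).X₂ := hF i
      have : Module.Flat R ((bottomSES F a).map (HomologicalComplex.eval _ _ i)).X₃ := hflat i
      exact flat_of_exact_of_flat _ _ hS.moduleCat_injective_f hS.moduleCat_surjective_g
        ((ShortComplex.ShortExact.moduleCat_exact_iff_function_exact _).1 hS.exact)
    refine HomVanish.obj₂ (triangleOfSES_distinguished (bottomSES_shortExact F a))
      ((ih F' (a + 1) h₃).mono (by lia)) ?_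
    have := hF a
    exact ((homVanish_char_of_flat (F.X a) X).single a).of_iso
      ((singleFunctorIsoCompQ _ a).symm.app _)

end Vanishing

/-! ### Adjunctions on derived categories -/

section LocalizedAdjunction

variable {C D : Type*} [Category* C] [Category* D] [Abelian C] [Abelian D]

/-- Adjoint functors induce adjoint functors on complexes. -/
def mapComplexAdj {L : C ⥤ D} {G : D ⥤ C} [L.Additive] [G.Additive] (adj : L ⊣ G) :
    L.mapHomologicalComplex (ComplexShape.up ℤ) ⊣ G.mapHomologicalComplex (ComplexShape.up ℤ) :=
  Adjunction.mkOfUnitCounit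
    { unit :=
        { app := fun X =>
            { f := fun i => adj.unit.app (X.X i)
              comm' := fun i j _ => (adj.unit.naturality (X.d i j)).symm }
          naturality := fun _ _ f => by ext i; exact adj.unit.naturality (f.f i) }
      counit :=
        { app := fun X =>
            { f := fun i => adj.counit.app (X.X i)
              comm' := fun i j _ => (adj.counit.naturality (X.d i j)).symm }
          naturality := fun _ _ f => by ext i; exact adj.counit.naturality (f.f i) }
      left_triangle := by
        ext X i
        exact (congrArg (_ ≫ ·) (Category.id_comp _)).trans
          (adj.left_triangle_components (X.X i))
      right_triangle := by
        ext X i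
        exact (congrArg (_ ≫ ·) (Category.id_comp _)).trans
          (adj.right_triangle_components (X.X i)) }

variable [HasDerivedCategory C] [HasDerivedCategory D]

/-- Exact adjoint functors induce adjoint functors on derived categories. -/
def mapDerivedCategoryAdj {L : C ⥤ D} {G : D ⥤ C} [L.Additive] [G.Additive]
    [Limits.PreservesFiniteLimits L] [Limits.PreservesFiniteColimits L]
    [Limits.PreservesFiniteLimits G] [Limits.PreservesFiniteColimits G] (adj : L ⊣ G) :
    L.mapDerivedCategory ⊣ G.mapDerivedCategory :=
  letI : CatCommSq (L.mapHomologicalComplex (ComplexShape.up ℤ)) Q Q L.mapDerivedCategory :=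
    ⟨L.mapDerivedCategoryFactors.symm⟩
  letI : CatCommSq (G.mapHomologicalComplex (ComplexShape.up ℤ)) Q Q G.mapDerivedCategory :=
    ⟨G.mapDerivedCategoryFactors.symm⟩
  (mapComplexAdj adj).localization Q (HomologicalComplex.quasiIso C (ComplexShape.up ℤ)) Q
    (HomologicalComplex.quasiIso D (ComplexShape.up ℤ)) _ _

end LocalizedAdjunction

/-! ### Ext into coextended modules -/

section Coextension

variable {A B : Type u} [CommRing A] [CommRing B] (φ : A →+* B)

/-- `B` as an `A`-module along a ring homomorphism `A → B`. -/
abbrev ringAlong : ModuleCat.{u} A := (ModuleCat.restrictScalars φ).obj (ModuleCat.of B B)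

instance : (ModuleCat.coextendScalars.{u, u, u} φ).Additive :=
  (ModuleCat.restrictCoextendScalarsAdj.{u} φ).right_adjoint_additive

instance : Limits.PreservesFiniteLimits (ModuleCat.coextendScalars.{u, u, u} φ) :=
  have := (ModuleCat.restrictCoextendScalarsAdj.{u} φ).rightAdjoint_preservesLimits
  inferInstance

lemma coextendScalars_map_surjective [Module.Projective A (ringAlong φ)] {X Y : ModuleCat.{u} A}
    (f : X ⟶ Y) (hf : Function.Surjective f.hom) :
    Function.Surjective ((ModuleCat.coextendScalars.{u, u, u} φ).map f).hom := by
  intro g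
  obtain ⟨h, hh⟩ := Module.projective_lifting_property f.hom
    (ModuleCat.CoextendScalars.equiv φ Y g) hf
  exact ⟨(ModuleCat.CoextendScalars.equiv φ X).symm h, hh⟩

/-- `Hom_A(B, -)` is exact because `B` is projective over `A`, so it descends to derived categories
as a right adjoint of restriction. -/
lemma preservesFiniteColimits_coextendScalars [Module.Projective A (ringAlong φ)] :
    Limits.PreservesFiniteColimits (ModuleCat.coextendScalars.{u, u, u} φ) := by
  have h := (Functor.preservesFiniteColimits_tfae
    (ModuleCat.coextendScalars.{u, u, u} φ)).out 0 3
  refine h.1 fun S hS => ⟨?_, ?_⟩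
  · have h' := (Functor.preservesFiniteLimits_tfae
      (ModuleCat.coextendScalars.{u, u, u} φ)).out 0 3
    exact (h'.2 inferInstance S hS).1
  · rw [ModuleCat.epi_iff_surjective]
    exact coextendScalars_map_surjective φ _ hS.moduleCat_surjective_g

/-- Extensions by a coextended module. -/
lemma HomVanish.coextendScalars [Module.Projective A (ringAlong φ)] {L : Cx B}
    {Z : ModuleCat.{u} A} {n : ℤ} (h : HomVanish (toD ((resCx φ).obj L)) Z n) :
    HomVanish (toD L) ((ModuleCat.coextendScalars φ).obj Z) n := by
  have := preservesFiniteColimits_coextendScalars φ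
  intro i hi f
  let G := (ModuleCat.coextendScalars.{u, u, u} φ).mapDerivedCategory
  let adj := mapDerivedCategoryAdj (ModuleCat.restrictCoextendScalarsAdj.{u} φ)
  let e : G.obj ((sglD 0 Z)⟦i⟧) ≅ (sglD 0 ((ModuleCat.coextendScalars φ).obj Z))⟦i⟧ :=
    (G.commShiftIso i).app _ ≪≫ (shiftFunctor _ i).mapIso
      ((Functor.mapDerivedCategorySingleFunctor _ 0).app Z)
  rw [← cancel_mono e.inv, Limits.zero_comp]
  apply (adj.homEquiv _ _).symm.injective
  rw [adj.homEquiv_counit, adj.homEquiv_counit, Functor.map_zero, Limits.zero_comp]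
  exact h.of_iso ((Functor.mapDerivedCategoryFactors _).app L) i hi _

end Coextension

/-! ### Adjoining one polynomial variable -/

section PolynomialStep

variable {A B : Type u} [CommRing A] [CommRing B] (φ : A →+* B) (t : B)
  (hb : Function.Bijective (Polynomial.eval₂RingHom φ t))

/-- Evaluation of polynomials at `t`, as an `A`-linear map. -/
def evalAlong : Polynomial A →ₗ[A] ringAlong φ where
  toFun := Polynomial.eval₂RingHom φ t
  map_add' := map_add (Polynomial.eval₂RingHom φ t)
  map_smul' := fun a p => by
    rw [Polynomial.smul_eq_C_mul]
    exact (map_mul (Polynomial.eval₂RingHom φ t) _ _).trans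
      (congrArg (· * Polynomial.eval₂RingHom φ t p) (Polynomial.eval₂_C φ t))

/-- The powers of a polynomial generator form a basis. -/
def basisOfPolynomial : Module.Basis ℕ A (ringAlong φ) :=
  (Polynomial.basisMonomials A).map (LinearEquiv.ofBijective (evalAlong φ t) hb)

lemma basisOfPolynomial_apply (n : ℕ) :
    basisOfPolynomial φ t hb n = (show ringAlong φ from (t ^ n : B)) := by
  rw [basisOfPolynomial, Module.Basis.map_apply, Polynomial.coe_basisMonomials]
  have h : Polynomial.eval₂ φ t (Polynomial.monomial n 1) = t ^ n := by
    rw [Polynomial.eval₂_monomial, map_one, one_mul]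
  exact h

variable (Y : ModuleCat.{u} B)

/-- The unit `Y → Hom_A(B, Y)`. -/
abbrev coextUnit : Y ⟶ (ModuleCat.coextendScalars φ).obj ((ModuleCat.restrictScalars φ).obj Y) :=
  (ModuleCat.restrictCoextendScalarsAdj.{u} φ).unit.app Y

/-- Multiplication by `t` on `B`, as an `A`-linear map. -/
def mulAlong : ringAlong φ →ₗ[A] ringAlong φ where
  toFun := fun b : B => (t * b : B)
  map_add' := fun a b : B => mul_add t a b
  map_smul' := fun a (b : B) => mul_left_comm t (φ a) b

/-- Multiplication by `t` on `Y`, as an `A`-linear map. -/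
def smulAlong : (ModuleCat.restrictScalars φ).obj Y →ₗ[A] (ModuleCat.restrictScalars φ).obj Y where
  toFun := fun y : Y => (t • y : Y)
  map_add' := fun a b : Y => smul_add t a b
  map_smul' := fun a (b : Y) => smul_comm t (φ a) b

/-- The endomorphism `f ↦ t f(-) - f(t -)` of `Hom_A(B, Y)`. -/
def coextCommutator : (ModuleCat.coextendScalars φ).obj ((ModuleCat.restrictScalars φ).obj Y) ⟶
    (ModuleCat.coextendScalars φ).obj ((ModuleCat.restrictScalars φ).obj Y) :=
  ModuleCat.ofHom
    { toFun := fun f => (ModuleCat.CoextendScalars.equiv φ _).symm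
        (smulAlong φ t Y ∘ₗ ModuleCat.CoextendScalars.equiv φ _ f -
          ModuleCat.CoextendScalars.equiv φ _ f ∘ₗ mulAlong φ t)
      map_add' := fun f g => ModuleCat.CoextendScalars.ext <| LinearMap.ext fun (b : B) => by
        change t • (coextApply φ f b + coextApply φ g b : Y) -
          (coextApply φ f (t * b) + coextApply φ g (t * b) : Y) =
          (t • (coextApply φ f b : Y) - (coextApply φ f (t * b) : Y)) +
          (t • (coextApply φ g b : Y) - (coextApply φ g (t * b) : Y))
        rw [smul_add]
        abel
      map_smul' := fun s f => ModuleCat.CoextendScalars.ext <| LinearMap.ext fun (b : B) => by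
        change t • (coextApply φ f (b * s) : Y) - (coextApply φ f (t * b * s) : Y) =
          t • (coextApply φ f (b * s) : Y) - (coextApply φ f (t * (b * s)) : Y)
        rw [mul_assoc] }

lemma coextCommutator_apply
    (f : (ModuleCat.coextendScalars φ).obj ((ModuleCat.restrictScalars φ).obj Y)) (b : B) :
    coextApply φ ((coextCommutator φ t Y).hom f) b =
      (t • (coextApply φ f b : Y) - (coextApply φ f (t * b) : Y) : Y) := rfl

lemma coext_ext {Z : ModuleCat.{u} A} {f g : (ModuleCat.coextendScalars φ).obj Z}
    (h : ∀ b, coextApply φ f b = coextApply φ g b) : f = g :=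
  ModuleCat.CoextendScalars.ext (LinearMap.ext h)

include hb in
lemma coext_ext_pow {Z : ModuleCat.{u} A} {f g : (ModuleCat.coextendScalars φ).obj Z}
    (h : ∀ n : ℕ, coextApply φ f (t ^ n) = coextApply φ g (t ^ n)) : f = g := by
  refine ModuleCat.CoextendScalars.ext ((basisOfPolynomial φ t hb).ext fun n => ?_)
  rw [basisOfPolynomial_apply]
  exact h n

include hb in
lemma exists_coextApply_pow {Z : ModuleCat.{u} A} (z : ℕ → Z) :
    ∃ f : (ModuleCat.coextendScalars φ).obj Z, ∀ n : ℕ, coextApply φ f (t ^ n) = z n := by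
  refine ⟨(ModuleCat.CoextendScalars.equiv φ Z).symm ((basisOfPolynomial φ t hb).constr A z),
    fun n => ?_⟩
  rw [← (basisOfPolynomial φ t hb).constr_basis A z n, basisOfPolynomial_apply]
  rfl

/-- The short exact sequence `0 → Y → Hom_A(B, Y) → Hom_A(B, Y) → 0`. -/
abbrev polynomialSES : ShortComplex (ModuleCat.{u} B) :=
  ShortComplex.mk (coextUnit φ Y) (coextCommutator φ t Y) <|
    ModuleCat.hom_ext <| LinearMap.ext fun y => coext_ext φ fun b => by
      change t • b • y - (t * b) • y = 0
      rw [mul_smul, sub_self]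

-- An `f` in the kernel commutes with `t`, hence is determined by `f(1)` on the basis of powers of
-- `t`. Surjectivity amounts to solving a recursion along these powers.
include hb in
lemma polynomialSES_shortExact : (polynomialSES φ t Y).ShortExact := by
  refine ModuleCat.shortComplex_shortExact _ ?_ ?_ ?_
  · intro f
    constructor
    · intro hf
      have hf' (b : B) : (coextApply φ f (t * b) : Y) = t • (coextApply φ f b : Y) := by
        have := congr(coextApply φ $hf b)
        rw [coextCommutator_apply] at this
        exact (sub_eq_zero.1 this).symm
      refine ⟨(coextApply φ f 1 : Y), coext_ext_pow φ t hb fun n => ?_⟩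
      change t ^ n • (coextApply φ f 1 : Y) = (coextApply φ f (t ^ n) : Y)
      induction n with
      | zero => rw [pow_zero, one_smul]
      | succ n ih => rw [pow_succ', mul_smul, ih, hf']
    · rintro ⟨y, rfl⟩
      exact congr($((polynomialSES φ t Y).zero).hom y)
  · intro y z h
    have : (1 : B) • (y : Y) = (1 : B) • (z : Y) := congr(coextApply φ $h 1)
    rwa [one_smul, one_smul] at this
  · intro g
    -- The required identity `t f(t^n) - f(t^{n+1}) = g(t^n)` is read as a recursion with `f(1) =
    -- 0`.
    obtain ⟨f, hf⟩ := exists_coextApply_pow φ t hb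
      (Z := (ModuleCat.restrictScalars φ).obj Y)
      (fun n => (Nat.rec (0 : Y) (fun n y => t • y - (show Y from coextApply φ g (t ^ n))) n : Y))
    refine ⟨f, coext_ext_pow φ t hb fun n => ?_⟩
    rw [coextCommutator_apply, ← pow_succ', hf, hf]
    exact sub_sub_cancel _ _

-- In the long exact sequence `Ext^i(L, Y)` sits between `Ext^{i-1}` and `Ext^i` into `Hom_A(B, Y)`,
-- both computed over `A`; the first of these costs the extra degree.
include hb in
lemma HomVanish.of_polynomial {L : Cx B} {n : ℤ}
    (h : HomVanish (toD ((resCx φ).obj L)) ((ModuleCat.restrictScalars φ).obj Y) n) :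
    HomVanish (toD L) Y (n + 1) := by
  have : Module.Projective A (ringAlong φ) := .of_basis (basisOfPolynomial φ t hb)
  have hG := h.coextendScalars φ
  intro i hi f
  -- Shifting the source normalizes `i` to `1`, where the triangle of the short exact sequence
  -- applies unshifted.
  let N : D B := (toD L)⟦1 - i⟧
  have hN := hG.shift (1 - i) _ rfl
  let e : toD L ≅ N⟦i - 1⟧ := ((shiftFunctorCompIsoId (D B) (1 - i) (i - 1) (by lia)).app _).symm
  rw [← cancel_epi e.inv, Limits.comp_zero]
  refine shift_hom_eq_zero (i - 1) i 1 (by lia) (fun g => ?_) (e.inv ≫ f)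
  have hS := polynomialSES_shortExact φ t hb Y
  obtain ⟨k, rfl⟩ := Triangle.coyoneda_exact₁ _ hS.singleTriangle_distinguished g
    (hN 1 (by lia) _)
  have hk : k = 0 := by
    rw [← cancel_mono ((shiftFunctorZero (D B) ℤ).app _).inv]
    exact (hN 0 (by lia) _).trans Limits.zero_comp.symm
  exact (congrArg (· ≫ _) hk).trans Limits.zero_comp

end PolynomialStep

/-! ### Polynomial rings in several variables -/

section PolynomialRings

lemma HomVanish.of_iso_right {R : Type u} [CommRing R] {N : D R} {Y Y' : ModuleCat.{u} R} {n : ℤ}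
    (h : HomVanish N Y n) (e : Y' ≅ Y) : HomVanish N Y' n := fun i hi f => by
  let e' := (shiftFunctor (D R) i).mapIso ((singleFunctor _ 0).mapIso e)
  rw [← cancel_mono e'.hom, Limits.zero_comp]
  exact h i hi _

variable {K A B : Type u} [CommRing K] [CommRing A] [CommRing B]

/-- Restriction of scalars for complexes along a composition. -/
def resCxCompIso (φ : K →+* A) (ψ : A →+* B) (L : Cx B) :
    (resCx (ψ.comp φ)).obj L ≅ (resCx φ).obj ((resCx ψ).obj L) :=
  (Functor.mapHomologicalComplexCompIso (ModuleCat.restrictScalarsComp.{u} φ ψ).symm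
    (ComplexShape.up ℤ)).symm.app L

section

variable (φ : A →+* B)

/-- Restriction of scalars commutes with character modules. -/
def resCharEquiv (X : ModuleCat.{u} B) :
    (ModuleCat.restrictScalars φ).obj (ModuleCat.of B (CharacterModule X)) ≃ₗ[A]
      ModuleCat.of A (CharacterModule ((ModuleCat.restrictScalars φ).obj X)) where
  toFun := fun f : CharacterModule X => (f : CharacterModule X)
  invFun := fun f : CharacterModule X => (f : CharacterModule X)
  map_add' := fun _ _ => rfl
  map_smul' := fun _ _ => rfl
  left_inv := fun _ => rfl
  right_inv := fun _ => rfl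

/-- Restriction of scalars commutes with character modules. -/
def resCharIso (X : ModuleCat.{u} B) :
    (ModuleCat.restrictScalars φ).obj (ModuleCat.of B (CharacterModule X)) ≅
      ModuleCat.of A (CharacterModule ((ModuleCat.restrictScalars φ).obj X)) :=
  (resCharEquiv φ X).toModuleIso

lemma bijective_coextUnit (hφ : Function.Bijective φ) (Y : ModuleCat.{u} B) :
    Function.Bijective (coextUnit φ Y).hom := by
  constructor
  · intro y z h
    have : (1 : B) • (y : Y) = (1 : B) • (z : Y) := congr(coextApply φ $h 1)
    rwa [one_smul, one_smul] at this
  · intro f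
    refine ⟨(coextApply φ f 1 : Y), coext_ext φ fun b => ?_⟩
    obtain ⟨a, rfl⟩ := hφ.2 b
    change φ a • (coextApply φ f 1 : Y) = coextApply φ f (φ a)
    refine (map_smul (ModuleCat.CoextendScalars.equiv φ _ f) a
      (show ringAlong φ from (1 : B))).symm.trans ?_
    exact congrArg (coextApply φ f) (mul_one (φ a))

lemma HomVanish.of_bijective (hφ : Function.Bijective φ) {L : Cx B} {Y : ModuleCat.{u} B} {n : ℤ}
    (h : HomVanish (toD ((resCx φ).obj L)) ((ModuleCat.restrictScalars φ).obj Y) n) :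
    HomVanish (toD L) Y n := by
  let e : A ≃ₗ[A] ringAlong φ := LinearEquiv.ofBijective
    ({ toFun := φ
       map_add' := map_add φ
       map_smul' := map_mul φ } : A →ₗ[A] ringAlong φ) hφ
  have : Module.Projective A (ringAlong φ) := .of_equiv e
  exact (h.coextendScalars φ).of_iso_right
    (LinearEquiv.ofBijective (coextUnit φ Y).hom (bijective_coextUnit φ hφ Y)).toModuleIso

end

/-- Each variable raises the bound by one: `finSuccEquiv` presents `B` as polynomials in one
variable over the ring in the remaining ones. -/
lemma HomVanish.of_mvPolynomial (e : ℕ) {B : Type u} [CommRing B] (φ : K →+* B)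
    (ψ : MvPolynomial (Fin e) K ≃+* B) (hψ : ∀ a, ψ (MvPolynomial.C a) = φ a) (L : Cx B)
    (Y : ModuleCat.{u} B) (n : ℤ)
    (h : HomVanish (toD ((resCx φ).obj L)) ((ModuleCat.restrictScalars φ).obj Y) n) :
    HomVanish (toD L) Y (n + e) := by
  induction e generalizing B with
  | zero =>
    rw [Nat.cast_zero, add_zero]
    refine h.of_bijective φ ?_
    have : ⇑φ = ψ ∘ MvPolynomial.C := funext fun a => (hψ a).symm
    rw [this]
    exact ψ.bijective.comp ((MvPolynomial.isEmptyRingEquiv K (Fin 0)).symm.bijective)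
  | succ e ih =>
    let ψ' : Polynomial (MvPolynomial (Fin e) K) ≃+* B :=
      (MvPolynomial.finSuccEquiv K e).symm.toRingEquiv.trans ψ
    let φ' : MvPolynomial (Fin e) K →+* B := (ψ' : _ →+* B).comp Polynomial.C
    have hφ : φ'.comp MvPolynomial.C = φ := by
      ext a
      rw [← hψ]
      exact congrArg ψ ((MvPolynomial.finSuccEquiv K e).symm.commutes a)
    have hψ' : Polynomial.eval₂RingHom φ' (ψ' Polynomial.X) = ψ' := by
      ext <;> simp [φ']
    have h' := ih (B := MvPolynomial (Fin e) K) MvPolynomial.C (RingEquiv.refl _) (fun _ => rfl)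
      ((resCx φ').obj L) ((ModuleCat.restrictScalars φ').obj Y) ?_
    · have := HomVanish.of_polynomial φ' (ψ' Polynomial.X) (by rw [hψ']; exact ψ'.bijective) Y h'
      exact this.mono (by push_cast; lia)
    · subst hφ
      exact (h.of_iso (Q.mapIso (resCxCompIso _ φ' L)).symm).of_iso_right
        ((ModuleCat.restrictScalarsComp.{u} _ φ').app Y).symm

/-- Finite flat dimension passes from the coefficients to a polynomial ring. -/
lemma homVanish_char_mvPolynomial (e : ℕ) (L : Cx (MvPolynomial (Fin e) K)) (n : ℤ)
    (h : ∀ X : ModuleCat.{u} K, HomVanish (toD ((resCx MvPolynomial.C).obj L))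
      (ModuleCat.of K (CharacterModule X)) n) (X : ModuleCat.{u} (MvPolynomial (Fin e) K)) :
    HomVanish (toD L) (ModuleCat.of _ (CharacterModule X)) (n + e) :=
  HomVanish.of_mvPolynomial e MvPolynomial.C (RingEquiv.refl _) (fun _ => rfl) L _ n
    ((h _).of_iso_right (resCharIso _ X))

end PolynomialRings

/-! ### Perfect complexes -/

section Perfect

variable {R : Type u} [CommRing R]

namespace IsPerfectCx

lemma shift {T : Cx R} (hT : IsPerfectCx T) (k : ℤ) : IsPerfectCx (T⟦k⟧) := by
  obtain ⟨a, b, _, _⟩ := hT.bounded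
  exact ⟨fun p => hT.finite (p + k), fun p => hT.projective (p + k), a - k, b - k,
    T.isStrictlyGE_shift a k _ (by lia), T.isStrictlyLE_shift b k _ (by lia)⟩

lemma single (G : ModuleCat.{u} R) [Module.Finite R G] [Module.Projective R G] (b : ℤ) :
    IsPerfectCx ((CochainComplex.singleFunctor (ModuleCat.{u} R) b).obj G) := by
  have e := (HomologicalComplex.singleObjXSelf (ComplexShape.up ℤ) b G).toLinearEquiv
  refine ⟨fun p => ?_, fun p => ?_, b, b, inferInstance, inferInstance⟩
  · by_cases h : p = b
    · subst h
      exact Module.Finite.equiv e.symm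
    · have := ModuleCat.subsingleton_of_isZero (isZero_single_X b p h G)
      infer_instance
  · by_cases h : p = b
    · subst h
      exact Module.Projective.of_equiv e.symm
    · have := ModuleCat.subsingleton_of_isZero (isZero_single_X b p h G)
      infer_instance

/-- The terms of a mapping cone. -/
def _root_.RelDual.mappingConeXEquiv {T T' : Cx R} (w : T ⟶ T') (p : ℤ) :
    (CochainComplex.mappingCone w).X p ≃ₗ[R] T.X (p + 1) × T'.X p :=
  (HomologicalComplex.homotopyCofiber.XIsoBiprod w p (p + 1) rfl ≪≫
    ModuleCat.biprodIsoProd _ _).toLinearEquiv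

lemma mappingCone {T T' : Cx R} (hT : IsPerfectCx T) (hT' : IsPerfectCx T') (w : T ⟶ T') :
    IsPerfectCx (CochainComplex.mappingCone w) := by
  have := hT.finite
  have := hT'.finite
  have := hT.projective
  have := hT'.projective
  refine ⟨fun p => .equiv (mappingConeXEquiv w p).symm,
    fun p => .of_equiv (mappingConeXEquiv w p).symm, ?_⟩
  obtain ⟨a, b, _, _⟩ := hT.bounded
  obtain ⟨a', b', _, _⟩ := hT'.bounded
  refine ⟨min (a - 1) a', max (b - 1) b', ?_, ?_⟩
  · rw [CochainComplex.isStrictlyGE_iff]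
    intro i hi
    rw [CochainComplex.mappingCone.isZero_X_iff]
    exact ⟨T.isZero_of_isStrictlyGE a _ (by lia), T'.isZero_of_isStrictlyGE a' _ (by lia)⟩
  · rw [CochainComplex.isStrictlyLE_iff]
    intro i hi
    rw [CochainComplex.mappingCone.isZero_X_iff]
    exact ⟨T.isZero_of_isStrictlyLE b _ (by lia), T'.isZero_of_isStrictlyLE b' _ (by lia)⟩

end IsPerfectCx

/-- Objects of the derived category isomorphic to perfect complexes. -/
def IsPerfect (X : D R) : Prop := ∃ T : Cx R, IsPerfectCx T ∧ Nonempty (X ≅ toD T)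

namespace IsPerfect

lemma of_iso {X Y : D R} (hX : IsPerfect X) (e : Y ≅ X) : IsPerfect Y := by
  obtain ⟨T, hT, ⟨e'⟩⟩ := hX
  exact ⟨T, hT, ⟨e ≪≫ e'⟩⟩

lemma shift {X : D R} (hX : IsPerfect X) (k : ℤ) : IsPerfect (X⟦k⟧) := by
  obtain ⟨T, hT, ⟨e⟩⟩ := hX
  exact ⟨T⟦k⟧, hT.shift k, ⟨(shiftFunctor _ k).mapIso e ≪≫ (Q.commShiftIso k).symm.app T⟩⟩

lemma sglD (G : ModuleCat.{u} R) [Module.Finite R G] [Module.Projective R G] (b : ℤ) :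
    IsPerfect (RelDual.sglD b G) :=
  ⟨_, .single G b, ⟨(singleFunctorIsoCompQ _ b).app G⟩⟩

/-- Perfect complexes are K-projective, so the first map is represented by a morphism of complexes,
and its mapping cone is perfect. -/
lemma obj₃ {Δ : Triangle (D R)} (hΔ : Δ ∈ distTriang _) (h₁ : IsPerfect Δ.obj₁)
    (h₂ : IsPerfect Δ.obj₂) : IsPerfect Δ.obj₃ := by
  obtain ⟨T, hT, ⟨e⟩⟩ := h₁
  obtain ⟨T', hT', ⟨e'⟩⟩ := h₂
  have := hT.isKProjective
  obtain ⟨w, hw⟩ := exists_Q_map_of_isKProjective (e.inv ≫ Δ.mor₁ ≫ e'.hom)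
  let i := isoTriangleOfIso₁₂ Δ _ hΔ (mappingCone_triangle_distinguished w) e e'
    ((e.hom_inv_id_assoc _).symm.trans (congrArg (e.hom ≫ ·) hw.symm))
  exact ⟨_, hT.mappingCone hT' w, ⟨Triangle.π₃.mapIso i⟩⟩

lemma obj₂ {Δ : Triangle (D R)} (hΔ : Δ ∈ distTriang _) (h₁ : IsPerfect Δ.obj₁)
    (h₃ : IsPerfect Δ.obj₃) : IsPerfect Δ.obj₂ :=
  ((obj₃ (rot_of_distTriang _ (rot_of_distTriang _ hΔ)) h₃ (h₁.shift 1)).shift (-1)).of_iso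
    ((shiftFunctorCompIsoId (D R) (1 : ℤ) (-1) (by lia)).app _).symm

end IsPerfect

lemma flat_restrictScalars {P : Type u} [CommRing P] (φ : P →+* R) [h : Module.Flat P (ringAlong φ)]
    (M : ModuleCat.{u} R) [Module.Flat R M] :
    Module.Flat P ((ModuleCat.restrictScalars φ).obj M) :=
  letI := φ.toAlgebra
  letI : Module P M := Module.compHom M φ
  have : IsScalarTower P R M := ⟨fun a b m => mul_smul (φ a) b m⟩
  have : Module.Flat P R := h
  Module.Flat.trans P R M

lemma finite_of_exact {S : ShortComplex (ModuleCat.{u} R)} [IsNoetherianRing R] (hS : S.Exact)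
    (h₁ : Module.Finite R S.X₁) (h₃ : Module.Finite R S.X₃) : Module.Finite R S.X₂ :=
  Module.Finite.of_exact (f := S.f.hom) (g := S.g.hom.rangeRestrict)
    (fun x => by
      rw [← (ShortComplex.ShortExact.moduleCat_exact_iff_function_exact _).1 hS x,
        ← LinearMap.mem_ker, LinearMap.ker_rangeRestrict, LinearMap.mem_ker])
    S.g.hom.surjective_rangeRestrict

/-- Maps from projective modules to homology are induced by morphisms of complexes. -/
lemma exists_epi_homologyMap_single (L : Cx R) (b : ℤ) (G : ModuleCat.{u} R) [Projective G]
    (g : G ⟶ L.homology b) [Epi g] :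
    ∃ s : (CochainComplex.singleFunctor (ModuleCat.{u} R) b).obj G ⟶ L,
      Epi (HomologicalComplex.homologyMap s b) := by
  let G' := (CochainComplex.singleFunctor (ModuleCat.{u} R) b).obj G
  let e : G'.X b ≅ G := HomologicalComplex.singleObjXSelf (ComplexShape.up ℤ) b G
  let h := Projective.factorThru g (L.homologyπ b)
  let s : G' ⟶ L := HomologicalComplex.mkHomFromSingle (h ≫ L.iCycles b) (by simp)
  have hs : s.f b = e.hom ≫ h ≫ L.iCycles b := HomologicalComplex.mkHomFromSingle_f _ _
  have h₁ : HomologicalComplex.cyclesMap s b = G'.iCycles b ≫ e.hom ≫ h := by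
    rw [← cancel_mono (L.iCycles b), HomologicalComplex.cyclesMap_i, hs, Category.assoc,
      Category.assoc]
  have h₂ : G'.homologyπ b ≫ HomologicalComplex.homologyMap s b =
      G'.iCycles b ≫ e.hom ≫ g := by
    rw [HomologicalComplex.homologyπ_naturality, h₁, Category.assoc, Category.assoc,
      Projective.factorThru_comp]
  have h₃ : IsIso (G'.iCycles b) := G'.isIso_iCycles b (b + 1) (by simp)
    ((isZero_single_X b _ (by lia) G).eq_of_tgt _ _)
  have h₄ : Epi (e.hom ≫ g) := epi_comp _ _
  have h₅ : Epi (G'.homologyπ b ≫ HomologicalComplex.homologyMap s b) := by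
    rw [h₂]
    exact epi_comp _ _
  exact ⟨s, epi_of_epi (G'.homologyπ b) _⟩

lemma exists_epi_of_finite (M : ModuleCat.{u} R) [Module.Finite R M] :
    ∃ (G : ModuleCat.{u} R) (g : G ⟶ M),
      Module.Finite R G ∧ Module.Projective R G ∧ Projective G ∧ Epi g := by
  obtain ⟨r, f, hf⟩ := Module.Finite.exists_fin' R M
  exact ⟨ModuleCat.of R (Fin r → R), ModuleCat.ofHom f,
    inferInstanceAs (Module.Finite R (Fin r → R)),
    inferInstanceAs (Module.Projective R (Fin r → R)),
    (IsProjective.iff_projective (R := R) (Fin r → R)).1 inferInstance,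
    (ModuleCat.epi_iff_surjective _).2 hf⟩

lemma isZero_homologyFunctor_sglD {i b : ℤ} (hi : i ≠ b) (G : ModuleCat.{u} R) :
    Limits.IsZero ((homologyFunctor (ModuleCat.{u} R) i).obj (sglD b G)) := by
  rcases lt_or_gt_of_ne hi with hi | hi
  · exact isZero_of_isGE _ b i hi
  · exact isZero_of_isLE _ b i hi

lemma finite_homologyFunctor_sglD (i b : ℤ) (G : ModuleCat.{u} R) [Module.Finite R G] :
    Module.Finite R ((homologyFunctor (ModuleCat.{u} R) i).obj (sglD b G)) := by
  by_cases hi : i = b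
  · subst hi
    have e : (homologyFunctor (ModuleCat.{u} R) i).obj (sglD i G) ≅ G :=
      (singleFunctorCompHomologyFunctorIso _ i).app G
    exact Module.Finite.equiv e.symm.toLinearEquiv
  · have := ModuleCat.subsingleton_of_isZero (isZero_homologyFunctor_sglD hi G)
    infer_instance

/-- A complex with finite homology in degree `b` receives a map from a finite free module placed in
degree `b` which is surjective in homology. -/
lemma exists_epi_homologyFunctor_map (N : D R) (b : ℤ)
    [Module.Finite R ((homologyFunctor (ModuleCat.{u} R) b).obj N)] :
    ∃ (G : ModuleCat.{u} R) (α : sglD b G ⟶ N), Module.Finite R G ∧ Module.Projective R G ∧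
      Epi ((homologyFunctor _ b).map α) := by
  let L := Q.objPreimage N
  let eL : toD L ≅ N := Q.objObjPreimageIso N
  have hL : Module.Finite R (L.homology b) :=
    Module.Finite.equiv ((homologyFunctor _ b).mapIso eL.symm ≪≫
      (homologyFunctorFactors _ b).app L).toLinearEquiv
  obtain ⟨G, g, hG₁, hG₂, hG₃, hg⟩ := exists_epi_of_finite (L.homology b)
  obtain ⟨s, hs⟩ := exists_epi_homologyMap_single L b G g
  refine ⟨G, (singleFunctorIsoCompQ _ b).hom.app G ≫ Q.map s ≫ eL.hom, hG₁, hG₂, ?_⟩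
  have h : Epi ((homologyFunctor _ b).map (Q.map s)) :=
    ((MorphismProperty.epimorphisms _).arrow_mk_iso_iff
      (((Functor.mapArrowFunctor _ _).mapIso (homologyFunctorFactors _ b)).app (Arrow.mk s))).2 hs
  have h' : Epi ((homologyFunctor _ b).map (Q.map s) ≫ (homologyFunctor _ b).map eL.hom) :=
    epi_comp _ _
  rw [Functor.map_comp, Functor.map_comp]
  exact epi_comp _ _

/-- Bounded complexes with finite homology and finite flat dimension over a suitable subring
are perfect. -/
theorem isPerfect_of_homVanish [IsNoetherianRing R] {P : Type u} [CommRing P] (φ : P →+* R)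
    [Module.Flat P (ringAlong φ)]
    (hφ : ∀ B : ModuleCat.{u} R, Module.Flat P ((ModuleCat.restrictScalars φ).obj B) →
      Module.Flat R B) (n : ℕ) (N : D R) (b c : ℤ) (hbc : b = c + n) [N.IsGE c] [N.IsLE b]
    (hN : ∀ i, Module.Finite R ((homologyFunctor (ModuleCat.{u} R) i).obj N))
    (h : ∀ X : ModuleCat.{u} P, HomVanish ((ModuleCat.restrictScalars φ).mapDerivedCategory.obj N)
      (ModuleCat.of P (CharacterModule X)) (-c)) : IsPerfect N := by
  induction n generalizing N b c with
  | zero =>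
    obtain rfl : b = c := by simpa using hbc
    obtain ⟨B, ⟨e⟩⟩ := exists_iso_singleFunctor_obj_of_isGE_of_isLE N b
    have h₁ : Module.Finite R B :=
      have := hN b
      Module.Finite.equiv (((homologyFunctor _ b).mapIso e ≪≫
        (singleFunctorCompHomologyFunctorIso _ b).app B).toLinearEquiv)
    have e' : RelDual.sglD 0 ((ModuleCat.restrictScalars φ).obj B) ≅
        ((ModuleCat.restrictScalars φ).mapDerivedCategory.obj N)⟦b⟧ :=
      ((singleFunctors (ModuleCat.{u} P)).shiftIso b 0 b (by lia)).symm.app _ ≪≫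
        (shiftFunctor _ b).mapIso ((Functor.mapDerivedCategorySingleFunctor _ b).symm.app B ≪≫
          (Functor.mapDerivedCategory _).mapIso e.symm)
    -- The complex is now one module in degree `b = c`, so the Ext bound `-c` says exactly that this
    -- module has no higher Ext into character modules over `P`.
    have h₂ : Module.Flat R B := hφ B <| flat_of_homVanish _ fun X =>
      ((h X).shift b 0 (by lia)).of_iso e'
    have h₃ : Module.FinitePresentation R B := Module.finitePresentation_of_finite R B
    have := Module.Flat.projective_of_finitePresentation (R := R) (M := B)
    exact (IsPerfect.sglD B b).of_iso e
  | succ n ih =>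
    have := hN b
    obtain ⟨G, α, hG₁, hG₂, hα⟩ := exists_epi_homologyFunctor_map N b
    obtain ⟨C, β, γ, hΔ⟩ := distinguished_cocone_triangle α
    have hC : C.IsGE c := by
      rw [isGE_iff]
      intro i hi
      exact (HomologySequence.exact₃ _ hΔ i (i + 1)).isZero_X₂
        ((isZero_of_isGE N c i hi).eq_of_src _ _)
        ((isZero_homologyFunctor_sglD (by lia) G).eq_of_tgt _ _)
    -- Surjectivity of `α` on `H^b` removes the top homology from the cone, shortening the amplitude
    -- by one.
    have hC' : C.IsLE (b - 1) := by
      rw [isLE_iff]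
      intro i hi
      refine (HomologySequence.exact₃ _ hΔ i (i + 1)).isZero_X₂ ?_
        ((isZero_homologyFunctor_sglD (by lia) G).eq_of_tgt _ _)
      by_cases h : i = b
      · subst h
        exact (HomologySequence.epi_homologyMap_mor₁_iff _ hΔ i).1 hα
      · exact (isZero_of_isLE N b i (by lia)).eq_of_src _ _
    refine IsPerfect.obj₂ hΔ (.sglD G b) (ih C (b - 1) c (by lia) (fun i => ?_) fun X => ?_)
    · exact finite_of_exact (HomologySequence.exact₃ _ hΔ i (i + 1)) (hN i)
        (finite_homologyFunctor_sglD _ b G)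
    -- The module `G` in degree `b` has bound `-b ≤ -c - 1`, so the bound `-c` persists for the
    -- cone.
    · refine HomVanish.obj₃ (Functor.map_distinguished
        (ModuleCat.restrictScalars φ).mapDerivedCategory _ hΔ) ?_ (h X)
      have := flat_restrictScalars φ G
      exact (((homVanish_char_of_flat _ X).single b).mono (by lia)).of_iso
        ((Functor.mapDerivedCategorySingleFunctor _ b).app G)

end Perfect

/-! ### Top differential forms -/

section Kaehler

/-- These subsets index the basis of the top exterior power, whence its rank is one. -/
instance (e : ℕ) : Unique (Set.powersetCard (Fin e) e) where
  default := ⟨Finset.univ, by simp⟩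
  uniq s := Subtype.ext (Finset.eq_univ_of_card _ (s.2.trans (Fintype.card_fin e).symm))

/-- The top exterior power of the differentials of a localized polynomial ring is free of
rank one. -/
def topFormsEquiv (K : Type u) [CommRing K] (e : ℕ) (V : Submonoid (MvPolynomial (Fin e) K)) :
    (⋀[Localization V]^e (Ω[Localization V⁄K])) ≃ₗ[Localization V] Localization V :=
  -- Localization is formally étale, so the differentials of `Q` are the base change of those of the
  -- polynomial ring, with basis the `dx_i`.
  have := Algebra.FormallyEtale.of_isLocalization (Rₘ := Localization V) V
  (((((KaehlerDifferential.mvPolynomialBasis K (Fin e)).baseChange (Localization V)).map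
    (KaehlerDifferential.tensorKaehlerEquivOfFormallyEtale K (MvPolynomial (Fin e) K)
      (Localization V))).exteriorPower e).equivFun).trans
    (LinearEquiv.funUnique _ (Localization V) (Localization V))

end Kaehler

/-! ### Finiteness of graded modules and of homology -/

section Finiteness

variable {R : Type u} [CommRing R]

/-- A finitely generated graded module is bounded. -/
lemma exists_bounds_of_finite_directSum (M : ℤ → Type u) [∀ i, AddCommGroup (M i)]
    [∀ i, Module R (M i)] [h : Module.Finite R (DirectSum ℤ M)] :
    ∃ a b : ℤ, ∀ i, i < a ∨ b < i → Subsingleton (M i) := by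
  classical
  obtain ⟨s, hs⟩ := h.fg_top
  -- A degree outside the supports of the finitely many generators contributes nothing.
  let t : Finset ℤ := s.biUnion fun x => DFinsupp.support x
  have ht (i : ℤ) (hi : i ∉ t) : Subsingleton (M i) := by
    have h0 : DirectSum.component R ℤ M i = 0 := by
      refine LinearMap.ext_on hs fun x hx => ?_
      by_contra hne
      exact hi (Finset.mem_biUnion.2 ⟨x, hx, DFinsupp.mem_support_iff.2 hne⟩)
    refine subsingleton_of_forall_eq 0 fun y => ?_
    rw [← DirectSum.component.lof_self R i y, h0, LinearMap.zero_apply]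
  obtain ⟨a, ha⟩ := t.bddBelow
  obtain ⟨b, hb⟩ := t.bddAbove
  refine ⟨a, b, fun i hi => ht i fun hit => ?_⟩
  have := ha hit
  have := hb hit
  lia

lemma finite_of_finite_directSum (M : ℤ → Type u) [∀ i, AddCommGroup (M i)]
    [∀ i, Module R (M i)] [Module.Finite R (DirectSum ℤ M)] (i : ℤ) : Module.Finite R (M i) :=
  .of_surjective (DirectSum.component R ℤ M i)
    fun y => ⟨DirectSum.lof R ℤ M i y, DirectSum.component.lof_self R i y⟩

lemma finite_directSum (M : ℤ → Type u) [∀ i, AddCommGroup (M i)]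
    [∀ i, Module R (M i)] (a b : ℤ) (h : ∀ i, i < a ∨ b < i → Subsingleton (M i))
    (h' : ∀ i, Module.Finite R (M i)) : Module.Finite R (DirectSum ℤ M) := by
  classical
  have key : ⨆ i : Finset.Icc a b, LinearMap.range (DirectSum.lof R ℤ M i) = ⊤ := by
    rw [eq_top_iff]
    rintro x -
    induction x using DirectSum.induction_on with
    | zero => exact zero_mem _
    | of i y =>
      by_cases hi : i ∈ Finset.Icc a b
      · exact Submodule.mem_iSup_of_mem ⟨i, hi⟩ ⟨y, rfl⟩
      · have := h i (by rw [Finset.mem_Icc] at hi; lia)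
        rw [Subsingleton.elim y 0, map_zero]
        exact zero_mem _
    | add x y hx hy => exact add_mem hx hy
  rw [Module.finite_def, ← key]
  exact Submodule.fg_iSup _ fun i => Module.Finite.iff_fg.1 inferInstance

/-- Finiteness of the restriction of scalars along a surjective homomorphism. -/
lemma finite_restrictScalars_iff {S : Type u} [CommRing S] (π : R →+* S)
    (hπ : Function.Surjective π) (M : ModuleCat.{u} S) :
    Module.Finite R ((ModuleCat.restrictScalars π).obj M) ↔ Module.Finite S M := by
  let := π.toAlgebra
  let : Module R M := Module.compHom M π
  have : IsScalarTower R S M := ⟨fun a b m => mul_smul (π a) b m⟩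
  have : Module.Finite R S := .of_surjective (Algebra.linearMap R S) hπ
  exact ⟨fun h => have : Module.Finite R M := h; Module.Finite.of_restrictScalars_finite R S M,
    fun h => have : Module.Finite R M := Module.Finite.trans S M; this⟩

/-- Restriction of scalars commutes with homology. -/
def resHomologyIso {S : Type u} [CommRing S] (π : R →+* S) (M : Cx S) (i : ℤ) :
    ((resCx π).obj M).homology i ≅ (ModuleCat.restrictScalars π).obj (M.homology i) :=
  (M.sc i).mapHomologyIso (ModuleCat.restrictScalars.{u} π)

end Finiteness

/-! ### Perfection over the localized polynomial ring -/

section Localization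

variable {K : Type u} [CommRing K] {e : ℕ} {V : Submonoid (MvPolynomial (Fin e) K)}

lemma flat_ringAlong_algebraMap (A B : Type u) [CommRing A] [CommRing B] [Algebra A B]
    [Module.Flat A B] : Module.Flat A (ringAlong (algebraMap A B)) :=
  Module.Flat.of_linearEquiv
    ({ AddEquiv.refl B with
        map_smul' := fun a (b : B) => ((Algebra.smul_def a b).symm :
          algebraMap A B a * b = a • b) } : ringAlong (algebraMap A B) ≃ₗ[A] B)

instance : Module.Flat (MvPolynomial (Fin e) K)
    (ringAlong (algebraMap (MvPolynomial (Fin e) K) (Localization V))) :=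
  have := IsLocalization.flat (Localization V) V
  flat_ringAlong_algebraMap _ _

lemma flat_of_flat_restrictScalars_localization (B : ModuleCat.{u} (Localization V))
    (h : Module.Flat (MvPolynomial (Fin e) K) ((ModuleCat.restrictScalars
      (algebraMap (MvPolynomial (Fin e) K) (Localization V))).obj B)) :
    Module.Flat (Localization V) B :=
  let : Module (MvPolynomial (Fin e) K) B :=
    Module.compHom B (algebraMap (MvPolynomial (Fin e) K) (Localization V))
  have : IsScalarTower (MvPolynomial (Fin e) K) (Localization V) B :=
    ⟨fun a b m => by rw [Algebra.smul_def]; exact mul_smul _ b m⟩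
  (Module.flat_iff_of_isLocalization (Localization V) V B).2 h

instance : Module.Flat K (ringAlong (algebraMap K (Localization V))) :=
  have := IsLocalization.flat (Localization V) V
  have := Module.Flat.trans K (MvPolynomial (Fin e) K) (Localization V)
  flat_ringAlong_algebraMap _ _

variable {S : Type u} [CommRing S] [Algebra K S] (π : Localization V →ₐ[K] S)

/-- Restriction of scalars to `K` factors through the localized polynomial ring. -/
def resBaseIso (M : Cx S) : (resCx (algebraMap K S)).obj M ≅
    (resCx (algebraMap K (Localization V))).obj ((resCx (π : Localization V →+* S)).obj M) :=
  eqToIso (by rw [← π.comp_algebraMap]) ≪≫ resCxCompIso _ _ M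

variable (V) in
/-- Restriction of scalars to `K` factors through the polynomial ring. -/
def resPolyIso (M : Cx (Localization V)) : (resCx (algebraMap K (Localization V))).obj M ≅
    (resCx MvPolynomial.C).obj
      ((resCx (algebraMap (MvPolynomial (Fin e) K) (Localization V))).obj M) :=
  eqToIso (by rw [IsScalarTower.algebraMap_eq K (MvPolynomial (Fin e) K)]; rfl) ≪≫
    resCxCompIso _ _ M

/-- Objects of `Df` restrict to perfect complexes over the localized polynomial ring. -/
theorem isPerfect_of_df [IsNoetherianRing K] (hπ : Function.Surjective π) (M : Cx S)
    (hM : Df K S (toD M)) : IsPerfect (toD ((resCx (π : Localization V →+* S)).obj M)) := by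
  obtain ⟨hfin, F, a, b, _, _, hF, ⟨eF⟩⟩ := hM
  obtain ⟨c, d, hcd⟩ := exists_bounds_of_finite_directSum (R := S) _ (h := hfin)
  have hfin' := finite_of_finite_directSum (R := S)
    (fun i => (homologyFunctor (ModuleCat.{u} S) i).obj (toD M))
  let N := (resCx (π : Localization V →+* S)).obj M
  have eH (i : ℤ) : (homologyFunctor _ i).obj (toD N) ≅ (ModuleCat.restrictScalars
      (π : Localization V →+* S)).obj ((homologyFunctor _ i).obj (toD M)) :=
    (homologyFunctorFactors _ i).app N ≪≫ resHomologyIso _ M i ≪≫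
      (ModuleCat.restrictScalars _).mapIso ((homologyFunctorFactors _ i).symm.app M)
  have hzero (i : ℤ) (hi : i < c ∨ d < i) :
      Limits.IsZero ((homologyFunctor (ModuleCat.{u} (Localization V)) i).obj (toD N)) := by
    have : Subsingleton ((ModuleCat.restrictScalars
      (π : Localization V →+* S)).obj ((homologyFunctor _ i).obj (toD M))) := hcd i hi
    exact (ModuleCat.isZero_of_subsingleton _).of_iso (eH i)
  -- One bound has to serve both for homology (`c`) and for Ext over `P` (`-a + e`, from the flat
  -- complex starting in degree `a`); `d'` keeps the amplitude nonnegative.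
  let c' := min c (a - e)
  let d' := max c' d
  have hc : (toD N).IsGE c' := (isGE_iff _ _).2 fun i hi => hzero i (by lia)
  have hd : (toD N).IsLE d' := (isLE_iff _ _).2 fun i hi => hzero i (by lia)
  have : IsNoetherianRing (Localization V) := IsLocalization.isNoetherianRing V _ inferInstance
  refine isPerfect_of_homVanish (algebraMap (MvPolynomial (Fin e) K) (Localization V))
    flat_of_flat_restrictScalars_localization (d' - c').toNat _ d' c' (by lia) (fun i => ?_)
    fun X => ?_
  · have := (finite_restrictScalars_iff (π : Localization V →+* S) hπ _).2 (hfin' i)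
    exact Module.Finite.equiv (eH i).symm.toLinearEquiv
  · refine ((homVanish_char_mvPolynomial e
      ((resCx (algebraMap (MvPolynomial (Fin e) K) (Localization V))).obj N) (-a)
      (fun Y => ?_) X).mono (by lia)).of_iso ((Functor.mapDerivedCategoryFactors _).app N)
    exact (homVanish_of_flat F a b hF Y).of_iso
      (Q.mapIso (resBaseIso π M ≪≫ resPolyIso V N).symm ≪≫
        (Functor.mapDerivedCategoryFactors _).symm.app M ≪≫ eF)

end Localization

/-! ### Membership in `D^f(σ)` -/

section Df

variable {K : Type u} [CommRing K] {S : Type u} [CommRing S] [Algebra K S]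

lemma Df.of_iso {X Y : D S} (hX : Df K S X) (e : Y ≅ X) : Df K S Y := by
  obtain ⟨hfin, F, a, b, ha, hb, hF, ⟨eF⟩⟩ := hX
  refine ⟨?_, F, a, b, ha, hb, hF, ⟨(Functor.mapDerivedCategory _).mapIso e ≪≫ eF⟩⟩
  obtain ⟨c, d, hcd⟩ := exists_bounds_of_finite_directSum (R := S) _ (h := hfin)
  have hfin' := finite_of_finite_directSum (R := S)
    (fun i => (homologyFunctor (ModuleCat.{u} S) i).obj X)
  have e' (i : ℤ) := ((homologyFunctor (ModuleCat.{u} S) i).mapIso e.symm).toLinearEquiv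
  exact finite_directSum (R := S) (fun i => (homologyFunctor (ModuleCat.{u} S) i).obj Y) c d
    (fun i hi => have := hcd i hi; (e' i).symm.toEquiv.subsingleton)
    (fun i => have := hfin' i; Module.Finite.equiv (e' i))

/-- The restriction of `S` to `K`. -/
def ringAlongIso : (ModuleCat.restrictScalars (algebraMap K S)).obj (ModuleCat.of S S) ≅
    ModuleCat.of K S :=
  ({ AddEquiv.refl S with
      map_smul' := fun a (b : S) => ((Algebra.smul_def a b).symm :
        algebraMap K S a * b = a • b) } : ringAlong (algebraMap K S) ≃ₗ[K] S).toModuleIso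

/-- Here finiteness of `fd_K S` enters: a finite flat resolution is the bounded flat complex
required over `K`. -/
lemma df_self (hfd : flatDimension K S < ⊤) : Df K S (toD (sgl S (ModuleCat.of S S))) := by
  obtain ⟨n, F, ε, hn, h0, hF, hε⟩ : ∃ n, HasFlatResolutionOfLength (ModuleCat.of K S) n := by
    by_contra! h
    refine hfd.ne (iInf_eq_top.2 fun n => iInf_eq_top.2 fun hn => (h n hn).elim)
  refine (show Df K S (sglD 0 (ModuleCat.of S S)) from
    ⟨finite_directSum (R := S)
      (fun i => (homologyFunctor (ModuleCat.{u} S) i).obj (sglD 0 (ModuleCat.of S S))) 0 0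
      (fun i hi => ModuleCat.subsingleton_of_isZero (isZero_homologyFunctor_sglD (by lia) _))
      (fun i => finite_homologyFunctor_sglD i 0 _), F, _, _, hn, h0, hF, ⟨?_⟩⟩).of_iso
      ((singleFunctorIsoCompQ _ 0).symm.app _)
  exact (Functor.mapDerivedCategorySingleFunctor _ 0).app _ ≪≫
    (singleFunctor _ 0).mapIso ringAlongIso ≪≫
    (singleFunctorIsoCompQ _ 0).app _ ≪≫ (asIso (Q.map ε)).symm

variable {e : ℕ} {V : Submonoid (MvPolynomial (Fin e) K)}

/-- A complex whose restriction to the localized polynomial ring is perfect is in `Df`. -/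
lemma df_of_isPerfectCx [IsNoetherianRing K] (π : Localization V →ₐ[K] S)
    (hπ : Function.Surjective π) (N : Cx S) (E : Cx (Localization V)) (hE : IsPerfectCx E)
    (f : toD ((resCx (π : Localization V →+* S)).obj N) ≅ toD E) : Df K S (toD N) := by
  have : IsNoetherianRing (Localization V) := IsLocalization.isNoetherianRing V _ inferInstance
  obtain ⟨a, b, _, _⟩ := hE.bounded
  have hEfin := hE.finite
  have hEproj := hE.projective
  have eH (i : ℤ) : (ModuleCat.restrictScalars (π : Localization V →+* S)).obj
      ((homologyFunctor _ i).obj (toD N)) ≅ E.homology i :=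
    (ModuleCat.restrictScalars _).mapIso ((homologyFunctorFactors _ i).app N) ≪≫
      (resHomologyIso _ N i).symm ≪≫ (homologyFunctorFactors _ i).symm.app _ ≪≫
        (homologyFunctor _ i).mapIso f ≪≫ (homologyFunctorFactors _ i).app E
  refine ⟨finite_directSum (R := S)
      (fun i => (homologyFunctor (ModuleCat.{u} S) i).obj (toD N)) a b (fun i hi => ?_)
      (fun i => ?_), (resCx (algebraMap K (Localization V))).obj E, a, b, inferInstance,
      inferInstance, fun i => flat_restrictScalars _ (E.X i), ⟨?_⟩⟩
  · have h : Limits.IsZero (E.homology i) := by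
      rcases hi with hi | hi
      · exact (E.exactAt_of_isGE a i hi).isZero_homology
      · exact (E.exactAt_of_isLE b i hi).isZero_homology
    have h' := ModuleCat.subsingleton_of_isZero (h.of_iso (eH i))
    exact h'
  · refine (finite_restrictScalars_iff (π : Localization V →+* S) hπ _).1 ?_
    have : Module.Finite (Localization V) (E.cycles i) :=
      Module.Finite.of_injective (E.iCycles i).hom
        ((ModuleCat.mono_iff_injective _).1 inferInstance)
    have : Module.Finite (Localization V) (E.homology i) :=
      Module.Finite.of_surjective (E.homologyπ i).hom
        ((ModuleCat.epi_iff_surjective _).1 inferInstance)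
    exact Module.Finite.equiv (eH i).symm.toLinearEquiv
  · exact (Functor.mapDerivedCategoryFactors _).app N ≪≫ Q.mapIso (resBaseIso π N) ≪≫
      (Functor.mapDerivedCategoryFactors _).symm.app _ ≪≫
      (Functor.mapDerivedCategory _).mapIso f ≪≫ (Functor.mapDerivedCategoryFactors _).app E

end Df

/-! ### Duality with respect to `D^σ` -/

section Dualizing

variable {R : Type u} [CommRing R]

/-- The terms of a shifted module. -/
def sglShiftXEquiv (M : ModuleCat.{u} R) (k : ℤ) : ((sgl R M)⟦k⟧).X (-k) ≃ₗ[R] M :=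
  (HomologicalComplex.singleObjXIsoOfEq (ComplexShape.up ℤ) 0 M (-k + k)
    (neg_add_cancel k)).toLinearEquiv

lemma isZero_sglShift_X (M : ModuleCat.{u} R) (k i : ℤ) (hi : i ≠ -k) :
    Limits.IsZero (((sgl R M)⟦k⟧).X i) :=
  isZero_single_X 0 (i + k) (by lia) M

/-- Coextension preserves injectives, and bounded below complexes of injectives are K-injective. -/
lemma isKInjective_coextCx {S : Type u} [CommRing S] (π : R →+* S) (I : Cx R) (a : ℤ)
    [I.IsStrictlyGE a] [∀ n, Injective (I.X n)] : ((coextCx π).obj I).IsKInjective := by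
  have (n : ℤ) : Injective (((coextCx π).obj I).X n) := injective_coextendScalars π (I.X n)
  exact CochainComplex.isKInjective_of_injective _ a

variable {K : Type u} [CommRing K] {S : Type u} [CommRing S] [Algebra K S]
  {e : ℕ} {V : Submonoid (MvPolynomial (Fin e) K)} (π : Localization V →ₐ[K] S)

/-- The module of top differential forms. -/
abbrev topForms (K : Type u) [CommRing K] (e : ℕ) (V : Submonoid (MvPolynomial (Fin e) K)) :
    ModuleCat.{u} (Localization V) :=
  ModuleCat.of (Localization V) (⋀[Localization V]^e (Ω[Localization V⁄K]))

/-- The shifted injective resolution of the module of top differential forms. -/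
abbrev shiftedForms (K : Type u) [CommRing K] (e : ℕ) (V : Submonoid (MvPolynomial (Fin e) K)) :
    Cx (Localization V) :=
  (KInjectiveResolution.ofModule (topForms K e V)).J⟦(e : ℤ)⟧

instance : (shiftedForms K e V).IsKInjective :=
  have := (KInjectiveResolution.ofModule (topForms K e V)).isKInjective
  inferInstance

/-- The augmentation of the shifted injective resolution. -/
abbrev shiftedFormsι : (sgl _ (topForms K e V))⟦(e : ℤ)⟧ ⟶ shiftedForms K e V :=
  (KInjectiveResolution.ofModule (topForms K e V)).ι⟦(e : ℤ)⟧'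

instance : QuasiIso (shiftedFormsι (K := K) (e := e) (V := V)) :=
  have := (KInjectiveResolution.ofModule (topForms K e V)).quasiIso
  inferInstance

instance : ((coextCx (π : Localization V →+* S)).obj (shiftedForms K e V)).IsKInjective := by
  let I := (injectiveResolution (topForms K e V)).cochainComplex
  have h₁ : (I⟦(e : ℤ)⟧).IsStrictlyGE (-e) := I.isStrictlyGE_shift 0 e (-e) (by lia)
  have h₂ (n : ℤ) : Injective ((I⟦(e : ℤ)⟧).X n) :=
    inferInstanceAs (Injective (I.X (n + e)))
  exact isKInjective_coextCx _ (I⟦(e : ℤ)⟧) (-e)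

/-- Shifts commute with coextension of scalars. -/
def coextShiftedFormsIso :
    (coextCx (π : Localization V →+* S)).obj (shiftedForms K e V) ≅ relDualizing π :=
  ((coextCx (π : Localization V →+* S)).commShiftIso (e : ℤ)).app _

variable (r : KInjectiveResolution (relDualizing π)) (hπ : Function.Surjective π)

/-- The comparison of the explicit model of the relative dualizing complex with a K-injective
resolution. -/
def toResolution : (coextCx (π : Localization V →+* S)).obj (shiftedForms K e V) ⟶ r.J :=
  (coextShiftedFormsIso π).hom ≫ r.ι

instance : QuasiIso (toResolution π r) := by
  have := r.quasiIso
  rw [toResolution]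
  infer_instance

include hπ in
/-- Duality with respect to the relative dualizing complex. -/
theorem df_rHom_and_quasiIso_biduality [IsNoetherianRing K] (M : Cx S) (hM : Df K S (toD M)) :
    Df K S (toD (RHom M r)) ∧ QuasiIso (biduality M r.J) := by
  obtain ⟨T, hT, ⟨f⟩⟩ := isPerfect_of_df π hπ M hM
  have := hT.isKProjective
  have := r.isKInjective
  obtain ⟨t, ht⟩ := exists_Q_map_of_isKProjective f.inv
  have : QuasiIso t := by
    rw [← isIso_Q_map_iff_quasiIso, ht]
    infer_instance
  have hL := isZero_sglShift_X (topForms K e V) e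
  let l : ((sgl _ (topForms K e V))⟦(e : ℤ)⟧).X (-e) ≃ₗ[Localization V] Localization V :=
    (sglShiftXEquiv (topForms K e V) e).trans (topFormsEquiv K e V)
  have h₁ := quasiIso_biduality_of_perfect hL l shiftedFormsι hT t
  have h₂ := quasiIso_biduality_coextCx (π : Localization V →+* S) M (shiftedForms K e V)
  refine ⟨?_, quasiIso_biduality_of_quasiIso M (toResolution π r)⟩
  have h₃ : QuasiIso (mapRight M (toResolution π r)) := quasiIso_mapRight_of_isKInjective _ _
  have h₄ := quasiIso_homAdj (π : Localization V →+* S) M (shiftedForms K e V)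
  have h₅ : QuasiIso (mapLeft t (shiftedForms K e V)) := quasiIso_mapLeft _ _
  have h₆ : QuasiIso (mapRight T (shiftedFormsι (K := K) (e := e) (V := V))) :=
    quasiIso_mapRight_of_isKProjective _ _
  -- Over `Q` the dual of `M` becomes `Hom_Q(T, Ω^e[e])`, a perfect complex: pass through the
  -- adjunction, replace `M` by `T`, then drop the injective resolution since `T` is K-projective.
  refine Df.of_iso (df_of_isPerfectCx π hπ _ _ (hT.homCx hL l) ?_)
    (asIso (Q.map (mapRight M (toResolution π r)))).symm
  exact asIso (Q.map (homAdj (π : Localization V →+* S) M (shiftedForms K e V))) ≪≫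
    asIso (Q.map (mapLeft t (shiftedForms K e V))) ≪≫
    (asIso (Q.map (mapRight T (shiftedFormsι (K := K) (e := e) (V := V))))).symm

end Dualizing

end RelDual

end

theorem theorem1p2 {K S : Type u} [CommRing K] [IsNoetherianRing K] [CommRing S] [Algebra K S]
    -- a presentation of `S` as a `K`-algebra essentially of finite type
    (e : ℕ) (V : Submonoid (MvPolynomial (Fin e) K)) (π : Localization V →ₐ[K] S)
    (hπ : Function.Surjective π)
    (hfd : RelDual.flatDimension K S < ⊤)
    -- a resolution by which the functor `RHom_S(-, D^σ)` is computed
    (r : RelDual.KInjectiveResolution (RelDual.relDualizing π)) :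
    (∀ M : RelDual.Cx S, RelDual.Df K S (RelDual.toD M) →
      RelDual.Df K S (RelDual.toD (RelDual.RHom M r)) ∧ IsIso (RelDual.bidualityD M r)) ∧
    RelDual.Df K S (RelDual.toD (RelDual.relDualizing π)) ∧ IsIso (RelDual.homothetyD r) := by
  have := r.isKInjective
  have := r.quasiIso
  refine ⟨fun M hM => ?_, ?_⟩
  · obtain ⟨h, h'⟩ := RelDual.df_rHom_and_quasiIso_biduality π r hπ M hM
    exact ⟨h, inferInstanceAs (IsIso (DerivedCategory.Q.map (RelDual.biduality M r.J)))⟩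
  -- Taking `M = S` gives both claims: evaluation at one identifies `RHom_S(S, D^σ)` with `D^σ`, and
  -- biduality of `S` yields the homothety isomorphism.
  · obtain ⟨h, h'⟩ := RelDual.df_rHom_and_quasiIso_biduality π r hπ _ (RelDual.df_self hfd)
    have h₁ := RelDual.quasiIso_homothety r.ι
    have h₂ := RelDual.quasiIso_evalOne r.J
    refine ⟨h.of_iso (asIso (DerivedCategory.Q.map r.ι) ≪≫
      (asIso (DerivedCategory.Q.map (RelDual.evalOne r.J))).symm), ?_⟩
    exact inferInstanceAs (IsIso (DerivedCategory.Q.map (RelDual.homothety r.ι)))
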